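/- Notation: $\log(k):=\lfloor\log_2 k\rfloor+1$ is the number of binary digits of $k\ge 1$, $\log\log(n):=\log(\log(n))$, and $\log^*(n)$ is the least $j\ge 0$ such that applying the real function $\log_2$ $j$ times to $n$ gives a value at most $1$. **MPMSC.** Let $\ell,\Delta\ge 1$ and $\Pi=\{p_1,\dots,p_\ell\}$. A Kripke model $(W,R,V)$ over $\Pi$ has *identifiers* if distinct nodes $w$ have distinct identifiers $\mathrm{ID}(w)=b_\ell\cdots b_1$, where $b_i=1$ iff $w\in V(p_i)$; the $i$th neighbour of $w$ is the $R$-successor of $w$ with the $i$th smallest identifier. Schemata are built from $\top$, the $p_i$ and schema variables with $\neg$, $\wedge$ and $\Diamond_1,\dots,\Diamond_\Delta$, where $\Diamond_i\varphi$ holds at $w$ iff $w$ has an $i$th neighbour and $\varphi$ holds there. A $(\Pi,\Delta)$-program of MPMSC has a finite nonempty ordered set of variables (its heads), for each head $X$ a terminal clause $X(0):=\varphi$, where $\varphi$ has no variables and no diamonds, and an iteration clause $X:=_{\varphi_1,\dots,\varphi_m}\psi_1;\dots;\psi_m;\chi$ with $m\ge 0$, where the conditions $\varphi_i$ have no diamonds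 and the $\psi_i$ and $\chi$ have modal depth at most $1$, and sets of attention heads and of print heads. In round $0$ each head has the truth value of its terminal clause. In round $t+1$ it has, at each node, the truth value of its hot body, which is $\psi_i$ for the least $i$ with $\varphi_i$ true and $\chi$ if there is none; all schemata are evaluated with the truth values of round $t$. The output round of a node is the first round in which an attention head is true there, and the node outputs the string of truth values of the print heads in that round. A round $t\geq 1$ is a *global communication round* if at some node the hot body of some head in that round contains a diamond. The *size* of a program is the number of occurrences of proposition symbols, heads and operators in its clauses. A *graph model* is a finite nonempty Kripke model over $\Pi$ with identifiers in which $R$ is symmetric and irreflexive and every node has at most $\Delta$ neighbours. The program *defines a proper $k$-colouring* if on every graph model every node outputs a string $0^a10^b$ with $0\le a<k$, and adjacent nodes output different strings. **Theorem.** For all integers $n\ge 1$ and $\Delta\ge 1$ there is a $(\Pi,\Delta)$-program $\Lambda_{\Delta,n}$ of MPMSC, where $\Pi=\{p_1,\dots,p_{\log(n)}\}$, such that the following hold. The constants in the $\mathcal O$-bounds of 2 and 3 are absolute. In particular, all of this applies to every graph with $n$ nodes, maximum degree at most $\Delta$ and distinct identifiers from $\{1,\dots,n\}$ written in binary. 1.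 $\Lambda_{\Delta,n}$ defines a proper $(\Delta+1)$-colouring. 2. $\Lambda_{\Delta,n}$ has $\mathcal O(\Delta\log(n))+\mathcal O(3^\Delta)$ heads and size $\mathcal O(\Delta^2\log(n))+\mathcal O(3^\Delta)$. 3. On every graph model, the output round of every node is $\mathcal O(\log(n)\cdot\log\log(n)\cdot\log^*(n))+\mathcal O(\Delta 3^\Delta)$. 4. On every graph model, the run of $\Lambda_{\Delta,n}$ has exactly $\log^*(n)+3^\Delta-\Delta+11$ global communication rounds, and none of them comes after the output round of any node. 5. For each fixed $\Delta\ge1$, the size of $\Lambda_{\Delta,n}$ is $\mathcal O(\log n)$ as $n\to\infty$. -/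

import Mathlib

universe u

namespace MPMSC

/-- The number of binary digits of a positive integer, `⌊log₂ n⌋ + 1`. -/
def bitLog (n : ℕ) : ℕ := Nat.log 2 n + 1

/-- The iterated logarithm: the least number of applications of the real function `log₂`
that takes `n` to a value at most `1`. -/
noncomputable def logStar (n : ℕ) : ℕ := sInf {j : ℕ | (Real.logb 2)^[j] (n : ℝ) ≤ 1}

/-- Schemata over the propositions `p_1, …, p_ℓ` (indexed by `Fin ℓ`), the schema variables in
`T` and the diamonds `◇_1, …, ◇_Δ` (indexed by `Fin Δ`). With `T` empty these are the formulas
without schema variables. -/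
inductive Schema (ℓ Δ : ℕ) (T : Type) : Type
  | top : Schema ℓ Δ T
  | prop (i : Fin ℓ) : Schema ℓ Δ T
  | var (X : T) : Schema ℓ Δ T
  | neg (φ : Schema ℓ Δ T) : Schema ℓ Δ T
  | and (φ ψ : Schema ℓ Δ T) : Schema ℓ Δ T
  | dia (i : Fin Δ) (φ : Schema ℓ Δ T) : Schema ℓ Δ T

namespace Schema

variable {ℓ Δ : ℕ} {T : Type}

/-- Modal depth. -/
def md : Schema ℓ Δ T → ℕ
  | top => 0
  | prop _ => 0
  | var _ => 0
  | neg φ => φ.md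
  | and φ ψ => max φ.md ψ.md
  | dia _ φ => φ.md + 1

/-- The number of occurrences of proposition symbols, schema variables and operators. -/
def length : Schema ℓ Δ T → ℕ
  | top => 1
  | prop _ => 1
  | var _ => 1
  | neg φ => φ.length + 1
  | and φ ψ => φ.length + ψ.length + 1
  | dia _ φ => φ.length + 1

end Schema

/-- A Kripke model over `p_1, …, p_ℓ`, all of them propositions that encode identifiers. -/
structure KripkeModel (ℓ : ℕ) (W : Type u) where
  /-- the accessibility relation -/
  R : W → W → Prop
  /-- the valuation -/
  V : Fin ℓ → Set W

namespace KripkeModel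

variable {ℓ : ℕ} {W : Type u} (M : KripkeModel ℓ W)

open Classical in
/-- The identifier of a node, the bit string `b_ℓ … b_1` with `b_i = 1` iff `p_i` holds, read as a
binary number; the order of these numbers is the lexicographic order of the strings. -/
noncomputable def ident (w : W) : ℕ := ∑ i : Fin ℓ, if w ∈ M.V i then 2 ^ (i : ℕ) else 0

/-- `v` is the neighbour of `w` with index `i`, counting from `0` in the order of identifiers. -/
def IsNeighbour (w : W) (i : ℕ) (v : W) : Prop :=
  M.R w v ∧ {x | M.R w x ∧ M.ident x < M.ident v}.ncard = i

/-- Finite nonempty Kripke models with identifiers in which every node has out-degree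
at most `Δ`, and whose accessibility relation is the edge relation of a graph. -/
structure IsGraphModel (Δ : ℕ) : Prop where
  finite : Finite W
  nonempty : Nonempty W
  ident_injective : Function.Injective M.ident
  degree_le : ∀ w, {v | M.R w v}.ncard ≤ Δ
  symm : ∀ v w, M.R v w → M.R w v
  irrefl : ∀ v, ¬ M.R v v

end KripkeModel

/-- Truth of a schema at a node, given the truth values `g` of the schema variables at all nodes. -/
def Schema.Holds {ℓ Δ : ℕ} {T : Type} {W : Type u} (M : KripkeModel ℓ W) (g : W → T → Prop) :
    Schema ℓ Δ T → W → Prop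
  | .top, _ => True
  | .prop i, w => w ∈ M.V i
  | .var X, w => g w X
  | .neg φ, w => ¬ φ.Holds M g w
  | .and φ ψ, w => φ.Holds M g w ∧ ψ.Holds M g w
  | .dia i φ, w => ∃ v, M.IsNeighbour w i v ∧ φ.Holds M g v

/-- The right-hand side of an iteration clause `X :=_{φ_1, …, φ_m} ψ_1; …; ψ_m; χ`: the list of
the pairs `(φ_i, ψ_i)` of a condition and its consequence, and the backup `χ`. An empty list is a
standard clause. -/
structure Rule (ℓ Δ : ℕ) (T : Type) where
  branches : List (Schema ℓ Δ T × Schema ℓ Δ T)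
  backup : Schema ℓ Δ T

namespace Rule

variable {ℓ Δ : ℕ} {T : Type}

open Classical in
/-- The consequence of the first condition that is true at `w`, or the last argument if there is
none. -/
noncomputable def select {W : Type u} (M : KripkeModel ℓ W) (g : W → T → Prop) (w : W) :
    List (Schema ℓ Δ T × Schema ℓ Δ T) → Schema ℓ Δ T → Schema ℓ Δ T
  | [], χ => χ
  | (φ, ψ) :: bs, χ => if φ.Holds M g w then ψ else select M g w bs χ

/-- The consequence of the hot condition, or the backup if that is hot. -/
noncomputable def hotBody {W : Type u} (r : Rule ℓ Δ T) (M : KripkeModel ℓ W) (g : W → T → Prop)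
    (w : W) : Schema ℓ Δ T :=
  select M g w r.branches r.backup

/-- The number of occurrences of symbols in the right-hand side of a clause. -/
def length (r : Rule ℓ Δ T) : ℕ :=
  (r.branches.map fun b => b.1.length + b.2.length).sum + r.backup.length

end Rule

/-- A program of message passing modal substitution calculus over `p_1, …, p_ℓ` with the diamonds
`◇_1, …, ◇_Δ`. Its head predicates, in their fixed order, are the elements of `Fin heads`. -/
structure Program (ℓ Δ : ℕ) where
  heads : ℕ
  heads_pos : 0 < heads
  terminal : Fin heads → Schema ℓ Δ Empty
  rule : Fin heads → Rule ℓ Δ (Fin heads)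
  attention : Finset (Fin heads)
  print : Finset (Fin heads)
  md_terminal : ∀ X, (terminal X).md = 0
  md_condition : ∀ X, ∀ b ∈ (rule X).branches, b.1.md = 0
  md_consequence : ∀ X, ∀ b ∈ (rule X).branches, b.2.md ≤ 1
  md_backup : ∀ X, (rule X).backup.md ≤ 1

namespace Program

variable {ℓ Δ : ℕ} (P : Program ℓ Δ)

/-- The size of a program: the number of occurrences of proposition symbols, head predicates and
operators in all its clauses, including the head predicates on the left-hand sides. -/
def size : ℕ := ∑ X, ((1 + (P.terminal X).length) + (1 + (P.rule X).length))

variable {W : Type u} (M : KripkeModel ℓ W)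

/-- The global configuration of round `t`. -/
noncomputable def config : ℕ → W → Fin P.heads → Prop
  | 0 => fun w X => (P.terminal X).Holds M (fun _ e => e.elim) w
  | t + 1 => fun w X => ((P.rule X).hotBody M (config t) w).Holds M (config t) w

/-- Node `w` accepts in round `t`: this is its output round, the first round in which an attention
predicate is true at `w`. -/
def AcceptsIn (w : W) (t : ℕ) : Prop :=
  (∃ X ∈ P.attention, P.config M t w X) ∧ ∀ s < t, ∀ X ∈ P.attention, ¬ P.config M s w X

open Classical in
/-- The truth values of the print predicates at `w` in round `t`, in the order of the heads. -/
noncomputable def printString (w : W) (t : ℕ) : List Bool :=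
  (P.print.sort (· ≤ ·)).map fun X => decide (P.config M t w X)

/-- Node `w` outputs the string `s` in round `t`. -/
def OutputsIn (w : W) (t : ℕ) (s : List Bool) : Prop :=
  P.AcceptsIn M w t ∧ P.printString M w t = s

/-- The set of global communication rounds: the rounds `t + 1` in which, at some node, the clause
of some head predicate evaluates a body that has a diamond. -/
def commRounds : Set ℕ :=
  {r | ∃ t, r = t + 1 ∧ ∃ w X, 0 < ((P.rule X).hotBody M (P.config M t) w).md}

/-- On every graph model, every node outputs a string `0^a 1 0^b` with `a < k`, and adjacent nodes
output different strings. -/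
def DefinesProperColoring (k : ℕ) : Prop :=
  ∀ (W : Type u) (M : KripkeModel ℓ W), M.IsGraphModel Δ →
    (∀ w, ∃ t a b, a < k ∧
      P.OutputsIn M w t (List.replicate a false ++ true :: List.replicate b false)) ∧
    ∀ v w, M.R v w → ∀ t t' s s', P.OutputsIn M v t s → P.OutputsIn M w t' s' → s ≠ s'

end Program

end MPMSC

open MPMSC Asymptotics Filter

namespace MPMSC

/-! ### Iterated logarithms -/

/-! The program runs Cole–Vishkin colour reduction on Δ functional graphs at once. In the `i`th one,
each node points to its `i`th neighbour, and properness only asks that a node and its target differ.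
The argument is local, so cycles and missing targets do no harm. Adjacent nodes are linked in at
least one of these graphs, so the tuple of the Δ colours is a proper colouring of the whole graph.

With ℓ = `bitLog n`, a reduction phase takes ℓ + 4 rounds: one to fetch the target's colour, ℓ + 2
to find the lowest differing bit `k`, one to load the colour 2`k` + (own bit `k`). The search is
serial: both colours are shift registers compared only at bit 0, and a binary counter records the
shifts, so the clauses of colour bits have constant size. Colours of `w` bits become colours below
2`w`; this map on widths follows log₂ up to an additive 4 (`natCast_reducedWidth_le`), so about log*
n phases bring the width to 3, and one more phase leaves six colours (`reduction_end`).

Three rounds of shifting down, each followed by the removal of one colour, leave three colours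
(`removal_step`). The Δ ternary digits then form a proper numbering below 3^Δ, kept in one-hot form
(`code_end`). Classes below Δ + 1 keep their number as final colour; each later class has one round,
in which its nodes take the least colour free among their neighbours (`greedy_end`).

All of this is driven by a clock that depends only on the round, not on the model. Hence all nodes
output in the same round (`acceptsIn_iff`), and the rounds with diamonds in hot bodies form a fixed
set (`exists_md_pos_iff`): one per phase, six for the removals, 3^Δ − Δ − 1 greedy ones. With log* n
+ 6 phases this is the stated number. The size bound is a sum over heads (`size_le`). -/

theorem exists_iterate_logb_le_one (k : ℕ) :
    ∀ x : ℝ, x ≤ k + 1 → ∃ j ≤ k, (Real.logb 2)^[j] x ≤ 1 := by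
  induction k with
  | zero => intro x hx; exact ⟨0, le_rfl, by simpa using hx⟩
  | succ k ih =>
    intro x hx
    by_cases h1 : x ≤ 1
    · exact ⟨0, Nat.zero_le _, by simpa using h1⟩
    -- One logarithm gains at least one, since k + 2 ≤ 2^(k + 1).
    · have hlog : Real.logb 2 x ≤ k + 1 := by
        rw [Real.logb_le_iff_le_rpow (by norm_num) (by linarith)]
        have h2 : k + 1 + 1 ≤ 2 ^ (k + 1) := Nat.lt_two_pow_self
        have h3 : ((k + 1 + 1 : ℕ) : ℝ) ≤ ((2 ^ (k + 1) : ℕ) : ℝ) := by exact_mod_cast h2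
        have h4 : (2 : ℝ) ^ ((k : ℝ) + 1) = ((2 ^ (k + 1) : ℕ) : ℝ) := by
          rw [show (k : ℝ) + 1 = ((k + 1 : ℕ) : ℝ) by push_cast; ring, Real.rpow_natCast]
          push_cast; ring
        rw [h4]
        push_cast at hx h3 ⊢
        linarith
      obtain ⟨j, hj, hj'⟩ := ih _ hlog
      exact ⟨j + 1, by omega, by simpa [Function.iterate_succ_apply] using hj'⟩

theorem exists_iterate_logb_natCast_le_one (n : ℕ) (hn : 1 ≤ n) :
    ∃ j ≤ bitLog n, (Real.logb 2)^[j] (n : ℝ) ≤ 1 := by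
  have hlog : Real.logb 2 (n : ℝ) ≤ (Nat.log 2 n : ℝ) + 1 := by
    rw [Real.logb_le_iff_le_rpow (by norm_num) (by exact_mod_cast hn)]
    rw [show (Nat.log 2 n : ℝ) + 1 = ((Nat.log 2 n + 1 : ℕ) : ℝ) by push_cast; ring,
      Real.rpow_natCast]
    exact_mod_cast (Nat.lt_pow_succ_log_self (by norm_num) n).le
  obtain ⟨j, hj, hj'⟩ := exists_iterate_logb_le_one _ _ hlog
  exact ⟨j + 1, by unfold bitLog; omega, by simpa [Function.iterate_succ_apply] using hj'⟩

theorem logStar_le_bitLog (n : ℕ) (hn : 1 ≤ n) : logStar n ≤ bitLog n := by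
  obtain ⟨j, hj, hj'⟩ := exists_iterate_logb_natCast_le_one n hn
  exact (Nat.sInf_le hj').trans hj

theorem iterate_logStar_le_one (n : ℕ) (hn : 1 ≤ n) :
    (Real.logb 2)^[logStar n] (n : ℝ) ≤ 1 := by
  obtain ⟨j, -, hj'⟩ := exists_iterate_logb_natCast_le_one n hn
  exact Nat.sInf_mem (s := {j : ℕ | (Real.logb 2)^[j] (n : ℝ) ≤ 1}) ⟨j, hj'⟩

theorem one_le_logStar (n : ℕ) (hn : 2 ≤ n) : 1 ≤ logStar n := by
  by_contra h
  have h0 : logStar n = 0 := by omega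
  have := iterate_logStar_le_one n (by omega)
  rw [h0] at this
  have h2 : (n : ℝ) ≤ 1 := by simpa using this
  have h3 : n ≤ 1 := by exact_mod_cast h2
  omega

/-- The number of bits needed after one colour reduction step on colours with `w` bits. -/
def reducedWidth (w : ℕ) : ℕ := Nat.clog 2 (2 * w)

theorem two_mul_le_two_pow_reducedWidth (w : ℕ) : 2 * w ≤ 2 ^ reducedWidth w :=
  Nat.le_pow_clog (by norm_num) _

theorem reducedWidth_le {w k : ℕ} (h : 2 * w ≤ 2 ^ k) : reducedWidth w ≤ k :=
  (Nat.clog_le_iff_le_pow (by norm_num)).2 h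

theorem two_mul_le_two_pow {k : ℕ} (hk : 3 ≤ k) : 2 * k ≤ 2 ^ k := by
  induction k, hk using Nat.le_induction with
  | base => norm_num
  | succ k hk ih => rw [pow_succ]; omega

theorem reducedWidth_le_of_le {w k : ℕ} (hk : 3 ≤ k) (h : w ≤ k) : reducedWidth w ≤ k :=
  reducedWidth_le (le_trans (by omega) (two_mul_le_two_pow hk))

theorem iterate_reducedWidth_le {w k : ℕ} (hk : 3 ≤ k) (h : w ≤ k) (m : ℕ) :
    reducedWidth^[m] w ≤ k := by
  induction m with
  | zero => simpa using h
  | succ m ih => rw [Function.iterate_succ_apply']; exact reducedWidth_le_of_le hk ih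

/-- Widths go 5 → 4 → 3, because 10 ≤ 2^4 and 8 ≤ 2^3, and the bound 3 then persists. -/
theorem iterate_reducedWidth_le_three_of_le_five {w : ℕ} (h : w ≤ 5) (m : ℕ) :
    reducedWidth^[m + 2] w ≤ 3 := by
  have h1 : reducedWidth w ≤ 4 := reducedWidth_le (by omega)
  have h2 : reducedWidth (reducedWidth w) ≤ 3 := reducedWidth_le (by omega)
  rw [Function.iterate_add_apply]
  exact iterate_reducedWidth_le le_rfl (by simpa using h2) m

/-- The slack 4 reproduces itself: 2w ≤ 2x + 8 ≤ 8x once x ≥ 2, log₂(8x) = 3 + log₂ x, and rounding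
up costs one more. This lets integer widths be compared with the real iterated logarithm. -/
theorem natCast_reducedWidth_le {w : ℕ} {x : ℝ} (hx : 2 ≤ x) (hw : (w : ℝ) ≤ x + 4) :
    (reducedWidth w : ℝ) ≤ Real.logb 2 x + 4 := by
  rcases Nat.lt_or_ge w 1 with h0 | h1
  · have : reducedWidth w ≤ 0 := reducedWidth_le (by omega)
    have h2 : (reducedWidth w : ℝ) ≤ 0 := by exact_mod_cast this
    have := Real.logb_nonneg (b := 2) (by norm_num) (show 1 ≤ x by linarith)
    linarith
  · have hpos : 0 < reducedWidth w := Nat.clog_pos (by norm_num) (by omega)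
    obtain ⟨r, hr⟩ := Nat.exists_eq_succ_of_ne_zero hpos.ne'
    have hlt : 2 ^ r < 2 * w := by
      by_contra hcon
      have := reducedWidth_le (not_lt.1 hcon)
      omega
    have hlt' : (2 : ℝ) ^ r ≤ 2 * w := by exact_mod_cast hlt.le
    have hrle : (r : ℝ) ≤ Real.logb 2 (8 * x) := by
      rw [Real.le_logb_iff_rpow_le (by norm_num) (by linarith), Real.rpow_natCast]
      linarith
    have h8 : Real.logb 2 (8 * x) = 3 + Real.logb 2 x := by
      rw [Real.logb_mul (by norm_num) (by linarith),
        show (8 : ℝ) = 2 ^ (3 : ℕ) by norm_num, Real.logb_pow, Real.logb_self_eq_one (by norm_num)]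
      norm_num
    rw [hr]; push_cast; linarith

theorem iterate_reducedWidth_le_three (j : ℕ) :
    ∀ (x : ℝ) (w : ℕ), (w : ℝ) ≤ x + 4 → (Real.logb 2)^[j] x ≤ 1 →
      reducedWidth^[j + 2] w ≤ 3 := by
  induction j with
  | zero =>
    intro x w hw hx
    have hx' : x ≤ 1 := by simpa using hx
    have : (w : ℝ) ≤ (5 : ℕ) := by push_cast; linarith
    exact iterate_reducedWidth_le_three_of_le_five (by exact_mod_cast this) 0
  | succ j ih =>
    intro x w hw hx
    by_cases h2 : 2 ≤ x
    · have := ih _ _ (natCast_reducedWidth_le h2 hw)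
        (by simpa [Function.iterate_succ_apply] using hx)
      rwa [show j + 1 + 2 = (j + 2) + 1 by ring, Function.iterate_succ_apply]
    -- Below 2 the comparison with log₂ is no longer available, but the width is already at most 5.
    · have : (w : ℝ) < (6 : ℕ) := by push_cast; linarith
      have : w < 6 := by exact_mod_cast this
      exact iterate_reducedWidth_le_three_of_le_five (by omega) (j + 1)

theorem bitLog_le (n : ℕ) : bitLog n ≤ n + 4 := by
  have := Nat.log_le_self 2 n
  unfold bitLog; omega

theorem iterate_reducedWidth_bitLog_le_three (n m : ℕ) (hn : 1 ≤ n) (hm : logStar n + 2 ≤ m) :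
    reducedWidth^[m] (bitLog n) ≤ 3 := by
  obtain ⟨k, rfl⟩ := Nat.exists_eq_add_of_le hm
  rw [Nat.add_comm, Function.iterate_add_apply]
  refine iterate_reducedWidth_le le_rfl ?_ k
  -- The comparison starts at x = n rather than at log₂ n; this is generous, but the number of
  -- phases leaves room for it.
  exact iterate_reducedWidth_le_three _ (n : ℝ) _ (by exact_mod_cast bitLog_le n)
    (iterate_logStar_le_one n hn)

/-! ### Elementary estimates for the size and the clock. -/

theorem sq_le_two_mul_two_pow (m : ℕ) : m ^ 2 ≤ 2 * 2 ^ m := by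
  rcases Nat.lt_or_ge m 3 with h | h
  · interval_cases m <;> norm_num
  · induction m, h using Nat.le_induction with
    | base => norm_num
    | succ m hm ih => rw [pow_succ 2]; nlinarith

/-- A counter of b bits has carry clauses of total size O(b²); this shows that such a cost is linear
in the number of colour bits. -/
theorem bitLog_sq_le {w : ℕ} (hw : 1 ≤ w) : bitLog w ^ 2 ≤ 4 * w := by
  have h1 := sq_le_two_mul_two_pow (bitLog w)
  have h2 : 2 ^ Nat.log 2 w ≤ w := Nat.pow_log_le_self 2 (by omega)
  have h3 : 2 ^ bitLog w = 2 * 2 ^ Nat.log 2 w := by unfold bitLog; rw [pow_succ]; ring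
  omega

theorem bitLog_le_self {w : ℕ} (hw : 1 ≤ w) : bitLog w ≤ w :=
  Nat.log_lt_self 2 (by omega)

theorem lt_two_pow_bitLog (w : ℕ) : w < 2 ^ bitLog w :=
  Nat.lt_pow_succ_log_self (by norm_num) w

/-- Absorbs the Δ + 1 palette clauses, each of size O(Δ²), into the 3^Δ term. -/
theorem cube_le_three_pow (d : ℕ) : d ^ 3 ≤ 3 ^ d := by
  rcases Nat.lt_or_ge d 3 with h | h
  · interval_cases d <;> norm_num
  · induction d, h using Nat.le_induction with
    | base => norm_num
    | succ d hd ih => rw [pow_succ 3]; nlinarith [mul_le_mul hd hd (by norm_num) (by omega)]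

theorem succ_lt_three_pow {d : ℕ} (hd : 1 ≤ d) : d + 1 < 3 ^ d := by
  induction d, hd using Nat.le_induction with
  | base => norm_num
  | succ d hd ih => rw [pow_succ]; omega

/-! ### Colour reduction on bit strings -/

/-- Drop the lowest bit of the first two numbers and count it, unless these bits differ. -/
def scanStep (s : ℕ × ℕ × ℕ) : ℕ × ℕ × ℕ :=
  if s.1 % 2 = s.2.1 % 2 then (s.1 / 2, s.2.1 / 2, s.2.2 + 1) else s

/-- The invariant of the serial search: k counts the equal low bits dropped so far, and the search
either is still running or has stopped for good at a differing bit. -/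
theorem iterate_scanStep (x y m : ℕ) :
    ∃ k ≤ m, scanStep^[m] (x, y, 0) = (x / 2 ^ k, y / 2 ^ k, k) ∧ x % 2 ^ k = y % 2 ^ k ∧
      (k = m ∨ x.testBit k ≠ y.testBit k) := by
  induction m with
  | zero => exact ⟨0, le_rfl, by simp, by simp [Nat.mod_one], Or.inl rfl⟩
  | succ m ih =>
    obtain ⟨k, hk, he, hmod, hor⟩ := ih
    have hbit : x / 2 ^ k % 2 = y / 2 ^ k % 2 ↔ x.testBit k = y.testBit k := by
      simp only [Nat.testBit_eq_decide_div_mod_eq]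
      rcases Nat.mod_two_eq_zero_or_one (x / 2 ^ k) with h | h <;>
      rcases Nat.mod_two_eq_zero_or_one (y / 2 ^ k) with h' | h' <;> simp [h, h']
    rw [Function.iterate_succ_apply', he]
    by_cases hb : x.testBit k = y.testBit k
    · have hkm : k = m := by tauto
      refine ⟨k + 1, by omega, ?_, ?_, Or.inl (by omega)⟩
      · simp only [scanStep, hbit, hb, if_true, Nat.div_div_eq_div_mul, ← pow_succ]
      · rw [pow_succ, Nat.mod_mul, Nat.mod_mul, hmod, hbit.2 hb]
    · refine ⟨k, by omega, ?_, hmod, Or.inr hb⟩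
      simp only [scanStep, hbit, hb, if_false]

/-- The new colour of a node with colour `x` whose successor has colour `y`, from `m` scan steps. -/
def reduceColour (m x y : ℕ) : ℕ :=
  2 * (scanStep^[m] (x, y, 0)).2.2 + (scanStep^[m] (x, y, 0)).1 % 2

/-- Distinct numbers of w bits differ below position w, so m ≥ w steps reach a differing bit. The
number m of steps may exceed w: the program always scans for the full register length. -/
theorem reduceColour_spec {m w x y : ℕ} (hx : x < 2 ^ w) (hy : y < 2 ^ w) (hwm : w ≤ m)
    (hxy : x ≠ y) :
    ∃ k < w, (scanStep^[m] (x, y, 0)).2.2 = k ∧ x.testBit k ≠ y.testBit k ∧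
      reduceColour m x y = 2 * k + (x.testBit k).toNat := by
  obtain ⟨k, hk, he, hmod, hor⟩ := iterate_scanStep x y m
  have hkw : k < w := by
    by_contra hcon
    have hle : 2 ^ w ≤ 2 ^ k := Nat.pow_le_pow_right (by norm_num) (by omega)
    rw [Nat.mod_eq_of_lt (by omega), Nat.mod_eq_of_lt (by omega)] at hmod
    exact hxy hmod
  refine ⟨k, hkw, by rw [he], hor.resolve_left (by omega), ?_⟩
  rw [reduceColour, he, Nat.toNat_testBit]

theorem reduceColour_lt {m w x y : ℕ} (hx : x < 2 ^ w) (hy : y < 2 ^ w) (hwm : w ≤ m)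
    (hxy : x ≠ y) : reduceColour m x y < 2 * w := by
  obtain ⟨k, hk, -, -, he⟩ := reduceColour_spec hx hy hwm hxy
  have := Bool.toNat_le (x.testBit k)
  omega

/-- The Cole–Vishkin argument: equal new colours would give the same position k for both nodes and
the same bit there, although k was chosen as a position where x and y differ. -/
theorem reduceColour_ne {m w x y z : ℕ} (hx : x < 2 ^ w) (hy : y < 2 ^ w) (hz : z < 2 ^ w)
    (hwm : w ≤ m) (hxy : x ≠ y) (hyz : y ≠ z) : reduceColour m x y ≠ reduceColour m y z := by
  obtain ⟨k, hk, -, hbit, he⟩ := reduceColour_spec hx hy hwm hxy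
  obtain ⟨k', hk', -, -, he'⟩ := reduceColour_spec hy hz hwm hyz
  have h1 := Bool.toNat_le (x.testBit k)
  have h2 := Bool.toNat_le (y.testBit k')
  intro h
  have hkk : k = k' := by omega
  subst hkk
  cases hb : x.testBit k <;> cases hb' : y.testBit k <;> simp_all

theorem scanStep_iterate_lt {w x y s : ℕ} (hx : x < 2 ^ w) (hy : y < 2 ^ w)
    (hxy : x ≠ y) : (scanStep^[s] (x, y, 0)).2.2 < w := by
  obtain ⟨k, hk, he, hmod, hor⟩ := iterate_scanStep x y s
  rw [he]
  by_contra hcon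
  have hle : 2 ^ w ≤ 2 ^ k := Nat.pow_le_pow_right (by norm_num) (by simpa using hcon)
  rw [Nat.mod_eq_of_lt (by omega), Nat.mod_eq_of_lt (by omega)] at hmod
  exact hxy hmod

/-- Ripple carry: bit b flips exactly when all lower bits are set. The right-hand side mirrors the
counter's iteration clause. -/
theorem testBit_add_one (k b : ℕ) :
    (k + 1).testBit b = true ↔
      ((k.testBit b = true ∧ ¬ ∀ a < b, k.testBit a = true) ∨
        (k.testBit b = false ∧ ∀ a < b, k.testBit a = true)) := by
  induction b generalizing k with
  | zero => simp [Nat.testBit_zero]; omega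
  | succ b ih =>
    have hall : (∀ a < b + 1, k.testBit a = true) ↔
        k % 2 = 1 ∧ ∀ a < b, (k / 2).testBit a = true := by
      constructor
      · intro h
        refine ⟨by simpa [Nat.testBit_zero] using h 0 (by omega), fun a ha => ?_⟩
        rw [Nat.testBit_div_two]; exact h (a + 1) (by omega)
      · rintro ⟨h0, h⟩ a ha
        rcases a with _ | a
        · simpa [Nat.testBit_zero] using h0
        · rw [Nat.testBit_succ]; exact h a (by omega)
    rw [Nat.testBit_succ, Nat.testBit_succ, hall]
    rcases Nat.mod_two_eq_zero_or_one k with h | h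
    · rw [show (k + 1) / 2 = k / 2 by omega]; simp [h]
    · rw [show (k + 1) / 2 = k / 2 + 1 by omega, ih]; simp [h]

end MPMSC

namespace MPMSC

/-! ### Derived connectives -/

namespace Schema

variable {ℓ Δ : ℕ} {T T' : Type}

/-- Falsity. -/
def bot : Schema ℓ Δ T := neg top

/-- Disjunction. -/
def or (φ ψ : Schema ℓ Δ T) : Schema ℓ Δ T := neg (and (neg φ) (neg ψ))

/-- Case distinction. -/
def ite (c φ ψ : Schema ℓ Δ T) : Schema ℓ Δ T := or (and c φ) (and (neg c) ψ)

/-- Exclusive disjunction. -/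
def xor (φ ψ : Schema ℓ Δ T) : Schema ℓ Δ T := or (and φ (neg ψ)) (and (neg φ) ψ)

/-- Conjunction of a list. -/
def conj : List (Schema ℓ Δ T) → Schema ℓ Δ T
  | [] => top
  | φ :: l => and φ (conj l)

/-- Disjunction of a list. -/
def disj : List (Schema ℓ Δ T) → Schema ℓ Δ T
  | [] => bot
  | φ :: l => or φ (disj l)

/-- The Boolean function `f` of the truth values of the given schemata. -/
def table : List (Schema ℓ Δ T) → (List Bool → Bool) → Schema ℓ Δ T
  | [], f => if f [] then top else bot
  | φ :: l, f => ite φ (table l fun bs => f (true :: bs)) (table l fun bs => f (false :: bs))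

section Holds

variable {W : Type u} (M : KripkeModel ℓ W) (g : W → T → Prop) (w : W)

@[simp] theorem holds_top : (top : Schema ℓ Δ T).Holds M g w := trivial

@[simp] theorem holds_prop (i : Fin ℓ) : (prop i : Schema ℓ Δ T).Holds M g w ↔ w ∈ M.V i := Iff.rfl

@[simp] theorem holds_var (X : T) : (var X : Schema ℓ Δ T).Holds M g w ↔ g w X := Iff.rfl

@[simp] theorem holds_neg (φ : Schema ℓ Δ T) : (neg φ).Holds M g w ↔ ¬ φ.Holds M g w := Iff.rfl

@[simp] theorem holds_and (φ ψ : Schema ℓ Δ T) :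
    (and φ ψ).Holds M g w ↔ φ.Holds M g w ∧ ψ.Holds M g w := Iff.rfl

@[simp] theorem holds_dia (i : Fin Δ) (φ : Schema ℓ Δ T) :
    (dia i φ).Holds M g w ↔ ∃ v, M.IsNeighbour w i v ∧ φ.Holds M g v := Iff.rfl

@[simp] theorem holds_bot : ¬ (bot : Schema ℓ Δ T).Holds M g w := by simp [bot]

@[simp] theorem holds_or (φ ψ : Schema ℓ Δ T) :
    (or φ ψ).Holds M g w ↔ φ.Holds M g w ∨ ψ.Holds M g w := by simp only [or, holds_neg, holds_and]; tauto

@[simp] theorem holds_ite (c φ ψ : Schema ℓ Δ T) :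
    (ite c φ ψ).Holds M g w ↔ (c.Holds M g w ∧ φ.Holds M g w) ∨ (¬ c.Holds M g w ∧ ψ.Holds M g w) := by
  simp [ite]

@[simp] theorem holds_xor (φ ψ : Schema ℓ Δ T) :
    (xor φ ψ).Holds M g w ↔
      (φ.Holds M g w ∧ ¬ ψ.Holds M g w) ∨ (¬ φ.Holds M g w ∧ ψ.Holds M g w) := by
  simp [xor]

@[simp] theorem holds_conj (l : List (Schema ℓ Δ T)) :
    (conj l).Holds M g w ↔ ∀ φ ∈ l, φ.Holds M g w := by
  induction l with
  | nil => simp [conj]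
  | cons φ l ih => simp [conj, ih]

@[simp] theorem holds_disj (l : List (Schema ℓ Δ T)) :
    (disj l).Holds M g w ↔ ∃ φ ∈ l, φ.Holds M g w := by
  induction l with
  | nil => simp [disj]
  | cons φ l ih => simp [disj, ih]

open Classical in
theorem holds_table (l : List (Schema ℓ Δ T)) (f : List Bool → Bool) :
    (table l f).Holds M g w ↔ f (l.map fun φ => decide (φ.Holds M g w)) = true := by
  induction l generalizing f with
  | nil => by_cases h : f [] = true <;> simp [table, h]
  | cons φ l ih => by_cases h : φ.Holds M g w <;> simp [table, ih, h]

end Holds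

/-! ### Modal depth and length of derived connectives. -/

section Measures

@[simp] theorem md_top : (top : Schema ℓ Δ T).md = 0 := rfl
@[simp] theorem md_prop (i : Fin ℓ) : (prop i : Schema ℓ Δ T).md = 0 := rfl
@[simp] theorem md_var (X : T) : (var X : Schema ℓ Δ T).md = 0 := rfl
@[simp] theorem md_neg (φ : Schema ℓ Δ T) : (neg φ).md = φ.md := rfl
@[simp] theorem md_and (φ ψ : Schema ℓ Δ T) : (and φ ψ).md = max φ.md ψ.md := rfl
@[simp] theorem md_dia (i : Fin Δ) (φ : Schema ℓ Δ T) : (dia i φ).md = φ.md + 1 := rfl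
@[simp] theorem md_bot : (bot : Schema ℓ Δ T).md = 0 := rfl
@[simp] theorem md_or (φ ψ : Schema ℓ Δ T) : (or φ ψ).md = max φ.md ψ.md := rfl
@[simp] theorem md_ite (c φ ψ : Schema ℓ Δ T) :
    (ite c φ ψ).md = max (max c.md φ.md) (max c.md ψ.md) := rfl
@[simp] theorem md_xor (φ ψ : Schema ℓ Δ T) : (xor φ ψ).md = max φ.md ψ.md := by simp [xor]

theorem md_conj_le {l : List (Schema ℓ Δ T)} {d : ℕ} (h : ∀ φ ∈ l, φ.md ≤ d) : (conj l).md ≤ d := by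
  induction l with
  | nil => simp [conj]
  | cons φ l ih => simp_all [conj]

theorem md_disj_le {l : List (Schema ℓ Δ T)} {d : ℕ} (h : ∀ φ ∈ l, φ.md ≤ d) : (disj l).md ≤ d := by
  induction l with
  | nil => simp [disj]
  | cons φ l ih => simp_all [disj]

theorem md_table_le {l : List (Schema ℓ Δ T)} {f : List Bool → Bool} {d : ℕ}
    (h : ∀ φ ∈ l, φ.md ≤ d) : (table l f).md ≤ d := by
  induction l generalizing f with
  | nil => by_cases h : f [] = true <;> simp [table, h]
  | cons φ l ih => simp_all [table]

/-- Every argument occurs in the table, even where `f` ignores it. Communication is counted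
syntactically, so this keeps the count of communication rounds exact. -/
theorem le_md_table {l : List (Schema ℓ Δ T)} {f : List Bool → Bool} {φ : Schema ℓ Δ T}
    (h : φ ∈ l) : φ.md ≤ (table l f).md := by
  induction l generalizing f with
  | nil => simp at h
  | cons ψ l ih =>
    rcases List.mem_cons.1 h with rfl | h
    · simp [table]
    · have := ih (f := fun bs => f (true :: bs)) h
      simp only [table, md_ite]
      omega

@[simp] theorem length_top : (top : Schema ℓ Δ T).length = 1 := rfl
@[simp] theorem length_prop (i : Fin ℓ) : (prop i : Schema ℓ Δ T).length = 1 := rfl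
@[simp] theorem length_var (X : T) : (var X : Schema ℓ Δ T).length = 1 := rfl
@[simp] theorem length_neg (φ : Schema ℓ Δ T) : (neg φ).length = φ.length + 1 := rfl
@[simp] theorem length_and (φ ψ : Schema ℓ Δ T) : (and φ ψ).length = φ.length + ψ.length + 1 := rfl
@[simp] theorem length_dia (i : Fin Δ) (φ : Schema ℓ Δ T) : (dia i φ).length = φ.length + 1 := rfl
@[simp] theorem length_bot : (bot : Schema ℓ Δ T).length = 2 := rfl
@[simp] theorem length_or (φ ψ : Schema ℓ Δ T) : (or φ ψ).length = φ.length + ψ.length + 4 := by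
  simp [or]; omega
@[simp] theorem length_ite (c φ ψ : Schema ℓ Δ T) :
    (ite c φ ψ).length = 2 * c.length + φ.length + ψ.length + 7 := by simp [ite]; omega
@[simp] theorem length_xor (φ ψ : Schema ℓ Δ T) :
    (xor φ ψ).length = 2 * φ.length + 2 * ψ.length + 8 := by simp [xor]; omega

theorem length_conj_le {l : List (Schema ℓ Δ T)} {c : ℕ} (h : ∀ φ ∈ l, φ.length ≤ c) :
    (conj l).length ≤ (c + 1) * l.length + 1 := by
  induction l with
  | nil => simp [conj]
  | cons φ l ih =>
    have h1 := ih fun φ hφ => h φ (List.mem_cons_of_mem _ hφ)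
    have h2 := h φ (by simp)
    simp only [conj, length_and, List.length_cons, mul_add]
    omega

theorem length_disj_le {l : List (Schema ℓ Δ T)} {c : ℕ} (h : ∀ φ ∈ l, φ.length ≤ c) :
    (disj l).length ≤ (c + 4) * l.length + 2 := by
  induction l with
  | nil => simp [disj]
  | cons φ l ih =>
    have h1 := ih fun φ hφ => h φ (List.mem_cons_of_mem _ hφ)
    have h2 := h φ (by simp)
    simp only [disj, length_or, List.length_cons, mul_add]
    omega

/-- The constant 13 = 2 · 3 + 7 is the cost of one case distinction, and adding it to the length
turns the recursion into plain doubling. -/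
theorem length_table_le {l : List (Schema ℓ Δ T)} {f : List Bool → Bool}
    (h : ∀ φ ∈ l, φ.length ≤ 3) : (table l f).length + 13 ≤ 15 * 2 ^ l.length := by
  induction l generalizing f with
  | nil => by_cases h : f [] = true <;> simp [table, h]
  | cons φ l ih =>
    have h0 : ∀ φ ∈ l, φ.length ≤ 3 := fun φ hφ => h φ (List.mem_cons_of_mem _ hφ)
    have h1 := ih (f := fun bs => f (true :: bs)) h0
    have h2 := ih (f := fun bs => f (false :: bs)) h0
    have h3 := h φ (by simp)
    simp only [table, length_ite, List.length_cons, pow_succ]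
    omega

end Measures

/-- Renaming of schema variables. -/
def map (f : T → T') : Schema ℓ Δ T → Schema ℓ Δ T'
  | top => top
  | prop i => prop i
  | var X => var (f X)
  | neg φ => neg (map f φ)
  | and φ ψ => and (map f φ) (map f ψ)
  | dia i φ => dia i (map f φ)

@[simp] theorem md_map (f : T → T') (φ : Schema ℓ Δ T) : (φ.map f).md = φ.md := by
  induction φ <;> simp_all [map]

@[simp] theorem length_map (f : T → T') (φ : Schema ℓ Δ T) : (φ.map f).length = φ.length := by
  induction φ <;> simp_all [map]

theorem holds_map {W : Type u} (M : KripkeModel ℓ W) (f : T → T') (g : W → T' → Prop)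
    (φ : Schema ℓ Δ T) (w : W) :
    (φ.map f).Holds M g w ↔ φ.Holds M (fun v X => g v (f X)) w := by
  induction φ generalizing w <;> simp_all [map]

end Schema

namespace Rule

variable {ℓ Δ : ℕ} {T T' : Type}

/-- Renaming of schema variables. -/
def map (f : T → T') (r : Rule ℓ Δ T) : Rule ℓ Δ T' where
  branches := r.branches.map fun b => (b.1.map f, b.2.map f)
  backup := r.backup.map f

@[simp] theorem length_map (f : T → T') (r : Rule ℓ Δ T) : (r.map f).length = r.length := by
  simp [map, length, Function.comp_def]

theorem hotBody_map {W : Type u} (M : KripkeModel ℓ W) (f : T → T') (g : W → T' → Prop)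
    (r : Rule ℓ Δ T) (w : W) :
    (r.map f).hotBody M g w = (r.hotBody M (fun v X => g v (f X)) w).map f := by
  obtain ⟨bs, χ⟩ := r
  simp only [hotBody, map]
  induction bs with
  | nil => rfl
  | cons b bs ih =>
    by_cases h : b.1.Holds M (fun v X => g v (f X)) w <;>
      simp [select, Schema.holds_map, ih, h]

end Rule

/-! ### Programs with an arbitrary finite type of heads -/

/-- A program whose heads are the elements of a type `T`, in no particular order. -/
structure TypedProgram (ℓ Δ : ℕ) (T : Type) where
  terminal : T → Schema ℓ Δ Empty
  rule : T → Rule ℓ Δ T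
  attention : Finset T
  print : Finset T
  md_terminal : ∀ X, (terminal X).md = 0
  md_condition : ∀ X, ∀ b ∈ (rule X).branches, b.1.md = 0
  md_consequence : ∀ X, ∀ b ∈ (rule X).branches, b.2.md ≤ 1
  md_backup : ∀ X, (rule X).backup.md ≤ 1

namespace TypedProgram

variable {ℓ Δ : ℕ} {T : Type} (Q : TypedProgram ℓ Δ T)

/-- The configuration of round `t`. -/
noncomputable def config {W : Type u} (M : KripkeModel ℓ W) : ℕ → W → T → Prop
  | 0 => fun w X => (Q.terminal X).Holds M (fun _ e => e.elim) w
  | t + 1 => fun w X => ((Q.rule X).hotBody M (config M t) w).Holds M (config M t) w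

variable [Fintype T] [Nonempty T]

/-- The program obtained by an enumeration of the heads. -/
noncomputable def toProgram : Program ℓ Δ where
  heads := Fintype.card T
  heads_pos := Fintype.card_pos
  terminal X := Q.terminal ((Fintype.equivFin T).symm X)
  rule X := (Q.rule ((Fintype.equivFin T).symm X)).map (Fintype.equivFin T)
  attention := Q.attention.map (Fintype.equivFin T).toEmbedding
  print := Q.print.map (Fintype.equivFin T).toEmbedding
  md_terminal X := Q.md_terminal _
  md_condition X b hb := by
    simp only [Rule.map, List.mem_map] at hb
    obtain ⟨b', hb', rfl⟩ := hb
    simpa using Q.md_condition _ b' hb'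
  md_consequence X b hb := by
    simp only [Rule.map, List.mem_map] at hb
    obtain ⟨b', hb', rfl⟩ := hb
    simpa using Q.md_consequence _ b' hb'
  md_backup X := by simpa [Rule.map] using Q.md_backup _

/-- The enumeration of the heads. -/
noncomputable def headEquiv : T ≃ Fin Q.toProgram.heads := Fintype.equivFin T

theorem terminal_toProgram (X : T) : Q.toProgram.terminal (Q.headEquiv X) = Q.terminal X :=
  congrArg Q.terminal ((Fintype.equivFin T).symm_apply_apply X)

theorem rule_toProgram (X : T) :
    Q.toProgram.rule (Q.headEquiv X) = (Q.rule X).map Q.headEquiv :=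
  congrArg (fun Y => (Q.rule Y).map (Fintype.equivFin T)) ((Fintype.equivFin T).symm_apply_apply X)

theorem mem_attention_toProgram (X : T) :
    Q.headEquiv X ∈ Q.toProgram.attention ↔ X ∈ Q.attention :=
  Finset.mem_map' (Fintype.equivFin T).toEmbedding

theorem mem_print_toProgram (X : T) : Q.headEquiv X ∈ Q.toProgram.print ↔ X ∈ Q.print :=
  Finset.mem_map' (Fintype.equivFin T).toEmbedding

theorem card_print_toProgram : Q.toProgram.print.card = Q.print.card :=
  Finset.card_map (Fintype.equivFin T).toEmbedding

theorem size_toProgram :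
    Q.toProgram.size = ∑ X : T, ((1 + (Q.terminal X).length) + (1 + (Q.rule X).length)) := by
  unfold Program.size
  refine (Fintype.sum_equiv Q.headEquiv _ _ fun X => ?_).symm
  rw [terminal_toProgram, rule_toProgram, Rule.length_map]

variable {W : Type u} (M : KripkeModel ℓ W)

theorem config_toProgram (t : ℕ) (w : W) (X : T) :
    Q.toProgram.config M t w (Q.headEquiv X) ↔ Q.config M t w X := by
  -- The induction needs all nodes and heads together, since diamonds and clauses read other nodes
  -- and other heads.
  have key : ∀ t, (fun (w : W) (X : T) => Q.toProgram.config M t w (Q.headEquiv X)) =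
      Q.config M t := by
    intro t
    induction t with
    | zero =>
      funext w X
      simp only [Program.config, config, terminal_toProgram]
    | succ t ih =>
      funext w X
      simp only [Program.config, config]
      rw [rule_toProgram, Rule.hotBody_map, Schema.holds_map, ih]
  exact iff_of_eq (congrFun (congrFun (key t) w) X)

theorem hotBody_toProgram (t : ℕ) (w : W) (X : T) :
    ((Q.toProgram.rule (Q.headEquiv X)).hotBody M (Q.toProgram.config M t) w).md =
      ((Q.rule X).hotBody M (Q.config M t) w).md := by
  rw [rule_toProgram, Rule.hotBody_map, Schema.md_map]
  congr 2
  funext v Y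
  exact propext (Q.config_toProgram M t v Y)

theorem commRounds_toProgram :
    Q.toProgram.commRounds M =
      {r | ∃ t, r = t + 1 ∧ ∃ w X, 0 < ((Q.rule X).hotBody M (Q.config M t) w).md} := by
  ext r
  simp only [Program.commRounds, Set.mem_ofPred_eq]
  refine exists_congr fun t => and_congr_right fun _ => exists_congr fun w => ?_
  rw [← Q.headEquiv.exists_congr_right]
  simp only [hotBody_toProgram]

theorem acceptsIn_toProgram (w : W) (t : ℕ) :
    Q.toProgram.AcceptsIn M w t ↔ (∃ X ∈ Q.attention, Q.config M t w X) ∧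
      ∀ s < t, ∀ X ∈ Q.attention, ¬ Q.config M s w X := by
  simp only [Program.AcceptsIn, ← Q.headEquiv.exists_congr_right,
    ← Q.headEquiv.forall_congr_right, mem_attention_toProgram, config_toProgram]

open Classical in
-- A one-hot output has the required shape in any order of the heads, so the arbitrary enumeration
-- does no harm.
theorem printString_toProgram {w : W} {t : ℕ} {X : T} (hX : X ∈ Q.print)
    (h : ∀ Y ∈ Q.print, Q.config M t w Y ↔ Y = X) :
    ∃ a b, a < Q.print.card ∧ Q.toProgram.printString M w t =
      List.replicate a false ++ true :: List.replicate b false := by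
  set s := Q.toProgram.print.sort (· ≤ ·) with hs
  have hmem : ∀ Z, Z ∈ s ↔ Z ∈ Q.toProgram.print := fun Z => by simp [hs]
  have hnodup : s.Nodup := Finset.sort_nodup _ _
  have hlen : s.length = Q.print.card := by
    rw [hs, Finset.length_sort, card_print_toProgram]
  obtain ⟨l₁, l₂, hl⟩ := List.append_of_mem ((hmem _).2 ((Q.mem_print_toProgram X).2 hX))
  have hval : ∀ Z ∈ s, decide (Q.toProgram.config M t w Z) = decide (Z = Q.headEquiv X) := by
    intro Z hZ
    obtain ⟨Y, rfl⟩ := Q.headEquiv.surjective Z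
    have hY := (Q.mem_print_toProgram Y).1 ((hmem _).1 hZ)
    simp [Q.config_toProgram M t w Y, h Y hY]
  rw [hl, List.nodup_append, List.nodup_cons] at hnodup
  obtain ⟨h₁, ⟨h₂, h₂'⟩, h₃⟩ := hnodup
  refine ⟨l₁.length, l₂.length, ?_, ?_⟩
  · rw [← hlen, hl]; simp
  · rw [Program.printString]
    change s.map _ = _
    rw [List.map_congr_left hval, hl, List.map_append, List.map_cons]
    congr 1
    · rw [List.eq_replicate_iff]
      refine ⟨by simp, fun b hb => ?_⟩
      obtain ⟨Z, hZ, rfl⟩ := List.mem_map.1 hb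
      have := h₃ Z hZ _ List.mem_cons_self
      simpa using this
    · congr 1
      · simp
      · rw [List.eq_replicate_iff]
        refine ⟨by simp, fun b hb => ?_⟩
        obtain ⟨Z, hZ, rfl⟩ := List.mem_map.1 hb
        have : Z ≠ Q.headEquiv X := fun hE => h₂ (hE ▸ hZ)
        simpa using this

theorem config_iff_of_printString_eq {v w : W} {t : ℕ}
    (h : Q.toProgram.printString M v t = Q.toProgram.printString M w t) {X : T}
    (hX : X ∈ Q.print) : Q.config M t v X ↔ Q.config M t w X := by
  simp only [Program.printString] at h
  have := List.map_inj_left.1 h (Q.headEquiv X) (by simp [mem_print_toProgram, hX])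
  simpa [config_toProgram] using this

end TypedProgram

end MPMSC

namespace MPMSC

/-! ### The colouring program -/

/-- The heads of the colouring program: a clock (`ring`, `phase`, `reducing`, `step`, `greedy`),
for each `i` the colour of the node in the functional graph of `i`th neighbours, the colour of its
`i`th neighbour and the index of the first bit in which they differ, the one-hot codes of the
sequences of the first `k` colours, and the colours of the final palette. -/
inductive Head (ℓ Δ N : ℕ) : Type
  | ring (q : Fin (ℓ + 4))
  | phase (p : Fin N)
  | reducing
  | step (k : Fin (3 ^ Δ + 7))
  | greedy
  | turn
  | colour (i : Fin Δ) (j : Fin (ℓ + 2))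
  | parent (i : Fin Δ) (j : Fin (ℓ + 2))
  | index (i : Fin Δ) (j : Fin (bitLog (ℓ + 2)))
  | code (k : Fin (Δ + 1)) (c : Fin (3 ^ (k : ℕ)))
  | palette (a : Fin (Δ + 1))

namespace Head

variable {ℓ Δ N : ℕ}

/-- The heads as a disjoint union of index types. -/
def equivSum : Head ℓ Δ N ≃ Fin (ℓ + 4) ⊕ Fin N ⊕ Unit ⊕ Fin (3 ^ Δ + 7) ⊕ Unit ⊕ Unit ⊕
    (Fin Δ × Fin (ℓ + 2)) ⊕ (Fin Δ × Fin (ℓ + 2)) ⊕ (Fin Δ × Fin (bitLog (ℓ + 2))) ⊕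
    (Σ k : Fin (Δ + 1), Fin (3 ^ (k : ℕ))) ⊕ Fin (Δ + 1) where
  toFun
    | ring q => .inl q
    | phase p => .inr (.inl p)
    | reducing => .inr (.inr (.inl ()))
    | step k => .inr (.inr (.inr (.inl k)))
    | greedy => .inr (.inr (.inr (.inr (.inl ()))))
    | turn => .inr (.inr (.inr (.inr (.inr (.inl ())))))
    | colour i j => .inr (.inr (.inr (.inr (.inr (.inr (.inl (i, j)))))))
    | parent i j => .inr (.inr (.inr (.inr (.inr (.inr (.inr (.inl (i, j))))))))
    | index i j => .inr (.inr (.inr (.inr (.inr (.inr (.inr (.inr (.inl (i, j)))))))))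
    | code k c => .inr (.inr (.inr (.inr (.inr (.inr (.inr (.inr (.inr (.inl ⟨k, c⟩)))))))))
    | palette a => .inr (.inr (.inr (.inr (.inr (.inr (.inr (.inr (.inr (.inr a)))))))))
  invFun
    | .inl q => ring q
    | .inr (.inl p) => phase p
    | .inr (.inr (.inl ())) => reducing
    | .inr (.inr (.inr (.inl k))) => step k
    | .inr (.inr (.inr (.inr (.inl ())))) => greedy
    | .inr (.inr (.inr (.inr (.inr (.inl ()))))) => turn
    | .inr (.inr (.inr (.inr (.inr (.inr (.inl (i, j))))))) => colour i j
    | .inr (.inr (.inr (.inr (.inr (.inr (.inr (.inl (i, j)))))))) => parent i j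
    | .inr (.inr (.inr (.inr (.inr (.inr (.inr (.inr (.inl (i, j))))))))) => index i j
    | .inr (.inr (.inr (.inr (.inr (.inr (.inr (.inr (.inr (.inl ⟨k, c⟩))))))))) => code k c
    | .inr (.inr (.inr (.inr (.inr (.inr (.inr (.inr (.inr (.inr a))))))))) => palette a
  left_inv X := by cases X <;> rfl
  right_inv X := by rcases X with _ | _ | _ | _ | _ | _ | _ | _ | _ | _ | _ <;> rfl

instance : Fintype (Head ℓ Δ N) := Fintype.ofEquiv _ equivSum.symm

instance : Nonempty (Head ℓ Δ N) := ⟨reducing⟩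

theorem sum_eq (f : Head ℓ Δ N → ℕ) :
    ∑ X, f X = ∑ q, f (ring q) + (∑ p, f (phase p) + (f reducing + (∑ k, f (step k) + (f greedy +
      (f turn + (∑ i, ∑ j, f (colour i j) + (∑ i, ∑ j, f (parent i j) +
      (∑ i, ∑ j, f (index i j) + (∑ k, ∑ c, f (code k c) + ∑ a, f (palette a)))))))))) := by
  rw [← Equiv.sum_comp equivSum.symm]
  simp only [Fintype.sum_sum_type, Fintype.sum_prod_type, Fintype.sum_sigma, Finset.univ_unique,
    Finset.sum_singleton]
  rfl

end Head

/-- The number with the given three bits. -/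
def ofBits (a b c : Bool) : ℕ := a.toNat + 2 * b.toNat + 4 * c.toNat

/-- The colour of the successor, or a different colour if there is no successor. -/
def shiftColour (x y : ℕ) (hasSucc : Bool) : ℕ :=
  if hasSucc then y else if x = 0 then 1 else 0

/-- A colour below `3` that differs from `x` and from `y`. -/
def thirdColour (x y : ℕ) : ℕ :=
  if x ≠ 0 ∧ y ≠ 0 then 0 else if x ≠ 1 ∧ y ≠ 1 then 1 else 2

/-- The colour `y` obtained by shifting, or another one if it is the colour `e` to be removed: `x`
is the colour before the shift and `z` the shifted colour of the successor. -/
def removeColour (e x y z : ℕ) : ℕ := if y = e then thirdColour x z else y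

/-- The bit `j` of the shifted colour as a function of bits. -/
def shiftBit (j : ℕ) : List Bool → Bool
  | [x₀, x₁, x₂, y₀, y₁, y₂, s] =>
    (shiftColour (ofBits x₀ x₁ x₂) (ofBits y₀ y₁ y₂) s).testBit j
  | _ => false

/-- The bit `j` of the new colour in the removal of the colour `e`, as a function of bits. -/
def removeBit (e j : ℕ) : List Bool → Bool
  | [x₀, x₁, x₂, y₀, y₁, y₂, z₀, z₁, z₂] =>
    (removeColour e (ofBits x₀ x₁ x₂) (ofBits y₀ y₁ y₂) (ofBits z₀ z₁ z₂)).testBit j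
  | _ => false

namespace Colouring

variable {ℓ Δ N : ℕ}

/-- The head `ring q`, or falsity if `q` is out of range. -/
def ringS (q : ℕ) : Schema ℓ Δ (Head ℓ Δ N) :=
  if h : q < ℓ + 4 then .var (.ring ⟨q, h⟩) else .bot

/-- The head `phase p`, or falsity if `p` is out of range. -/
def phaseS (p : ℕ) : Schema ℓ Δ (Head ℓ Δ N) :=
  if h : p < N then .var (.phase ⟨p, h⟩) else .bot

/-- The head `step k`, or falsity if `k` is out of range. -/
def stepS (k : ℕ) : Schema ℓ Δ (Head ℓ Δ N) :=
  if h : k < 3 ^ Δ + 7 then .var (.step ⟨k, h⟩) else .bot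

/-- The head `colour i j`, or falsity if `j` is out of range. -/
def colourS (i : Fin Δ) (j : ℕ) : Schema ℓ Δ (Head ℓ Δ N) :=
  if h : j < ℓ + 2 then .var (.colour i ⟨j, h⟩) else .bot

/-- The head `parent i j`, or falsity if `j` is out of range. -/
def parentS (i : Fin Δ) (j : ℕ) : Schema ℓ Δ (Head ℓ Δ N) :=
  if h : j < ℓ + 2 then .var (.parent i ⟨j, h⟩) else .bot

/-- The head `index i j`, or falsity if `j` is out of range. -/
def indexS (i : Fin Δ) (j : ℕ) : Schema ℓ Δ (Head ℓ Δ N) :=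
  if h : j < bitLog (ℓ + 2) then .var (.index i ⟨j, h⟩) else .bot

/-- The head `code k c`, or falsity if `k` or `c` is out of range. -/
def codeS (k c : ℕ) : Schema ℓ Δ (Head ℓ Δ N) :=
  if h : k < Δ + 1 then if h' : c < 3 ^ k then .var (.code ⟨k, h⟩ ⟨c, h'⟩) else .bot else .bot

/-- The last round of the last phase. -/
def lastS : Schema ℓ Δ (Head ℓ Δ N) := .and (ringS (ℓ + 3)) (phaseS (N - 1))

/-- The lowest bits of the colour and of the colour of the `i`th neighbour differ. -/
def differS (i : Fin Δ) : Schema ℓ Δ (Head ℓ Δ N) := .xor (colourS i 0) (parentS i 0)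

/-- The bit `j` of the colour of the `i`th neighbour, or of the complement of the own colour. -/
def fetchS (i : Fin Δ) (j : ℕ) : Schema ℓ Δ (Head ℓ Δ N) :=
  .or (.dia i (colourS i j)) (.neg (.or (colourS i j) (.dia i .top)))

/-- The bit `j` of the shifted colour. -/
def shiftS (i : Fin Δ) (j : ℕ) : Schema ℓ Δ (Head ℓ Δ N) :=
  .table [colourS i 0, colourS i 1, colourS i 2, .dia i (colourS i 0), .dia i (colourS i 1),
    .dia i (colourS i 2), .dia i .top] (shiftBit j)

/-- The bit `j` of the new colour in the removal of the colour `e`. -/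
def removeS (e : ℕ) (i : Fin Δ) (j : ℕ) : Schema ℓ Δ (Head ℓ Δ N) :=
  .table [colourS i 0, colourS i 1, colourS i 2, parentS i 0, parentS i 1, parentS i 2,
    .dia i (parentS i 0), .dia i (parentS i 1), .dia i (parentS i 2)] (removeBit e j)

/-- The bit `j` of the colour equals `b`. -/
def bitS (i : Fin Δ) (j : ℕ) (b : Bool) : Schema ℓ Δ (Head ℓ Δ N) :=
  if b then colourS i j else .neg (colourS i j)

/-- The `i`th colour is `d`, for colours below `4`. -/
def digitS (i d : ℕ) : Schema ℓ Δ (Head ℓ Δ N) :=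
  if h : i < Δ then .and (bitS ⟨i, h⟩ 0 (d.testBit 0)) (bitS ⟨i, h⟩ 1 (d.testBit 1)) else .bot

/-- No neighbour has the final colour `a`. -/
def freeS (a : Fin (Δ + 1)) : Schema ℓ Δ (Head ℓ Δ N) :=
  .conj ((List.finRange Δ).map fun i => .neg (.dia i (.var (.palette a))))

/-- The colour `a` is the least final colour that no neighbour has. -/
def leastFreeS (a : Fin (Δ + 1)) : Schema ℓ Δ (Head ℓ Δ N) :=
  .and (freeS a) (.conj (((List.finRange (Δ + 1)).filter (· < a)).map fun b => .neg (freeS b)))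

/-- The terminal clauses. -/
def terminal : Head ℓ Δ N → Schema ℓ Δ Empty
  | .ring q => if (q : ℕ) = 0 then .top else .bot
  | .phase p => if (p : ℕ) = 0 then .top else .bot
  | .reducing => .top
  | .colour _ j => if h : (j : ℕ) < ℓ then .prop ⟨j, h⟩ else .bot
  | _ => .bot

/-- The iteration clauses. -/
def rule : Head ℓ Δ N → Rule ℓ Δ (Head ℓ Δ N)
  | .ring q => ⟨[], if (q : ℕ) = 0 then ringS (ℓ + 3) else ringS (q - 1)⟩
  | .phase p => ⟨[],
      .ite (ringS (ℓ + 3)) (if (p : ℕ) = 0 then .bot else phaseS (p - 1)) (.var (.phase p))⟩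
  | .reducing => ⟨[], .and (.var .reducing) (.neg lastS)⟩
  | .step k => ⟨[], if (k : ℕ) = 0 then lastS else stepS (k - 1)⟩
  | .greedy => ⟨[], .or (stepS (6 + Δ)) (.and (.var .greedy) (.neg (stepS (5 + 3 ^ Δ))))⟩
  -- The test is made one round ahead and stored in a single head, so that its size O(3^Δ) is paid
  -- once and not in each palette clause.
  | .turn => ⟨[], .disj ((List.range (3 ^ Δ - (Δ + 1))).map fun r =>
      .and (stepS (6 + Δ + r)) (codeS Δ (Δ + 1 + r)))⟩
  | .colour i j => ⟨[
      (.and (.var .reducing) (ringS 0), .var (.colour i j)),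
      (.and (.var .reducing) (ringS (ℓ + 3)),
        if (j : ℕ) = 0 then colourS i 0 else indexS i (j - 1)),
      (.and (.var .reducing) (differS i), .var (.colour i j)),
      (.var .reducing, colourS i (j + 1)),
      (stepS 1, removeS 5 i j),
      (stepS 3, removeS 4 i j),
      (stepS 5, removeS 3 i j)], .var (.colour i j)⟩
  | .parent i j => ⟨[
      (.and (.var .reducing) (ringS 0), fetchS i j),
      (.and (.var .reducing) (differS i), .var (.parent i j)),
      (.var .reducing, parentS i (j + 1)),
      (.or (stepS 0) (.or (stepS 2) (stepS 4)), shiftS i j)], .var (.parent i j)⟩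
  | .index i j => ⟨[
      (ringS 0, .bot),
      (differS i, .var (.index i j))],
      .xor (.var (.index i j)) (.conj ((List.range j).map fun a => indexS i a))⟩
  -- Each prefix code extends the previous one by a single digit. This keeps all clauses of constant
  -- size, at the price of Δ rounds without communication.
  | .code k c => ⟨[],
      if (k : ℕ) = 0 then .top else .and (codeS (k - 1) (c / 3)) (digitS (k - 1) (c % 3))⟩
  | .palette a => ⟨[
      (stepS (6 + Δ), codeS Δ a),
      (.var .greedy, .ite (.var .turn) (leastFreeS a) (.var (.palette a)))], .var (.palette a)⟩

/-! ### Modal depth and length of the program's schemata. -/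

section Measures

@[simp] theorem md_ringS (q : ℕ) : (ringS q : Schema ℓ Δ (Head ℓ Δ N)).md = 0 := by
  unfold ringS; split_ifs <;> rfl
@[simp] theorem md_phaseS (q : ℕ) : (phaseS q : Schema ℓ Δ (Head ℓ Δ N)).md = 0 := by
  unfold phaseS; split_ifs <;> rfl
@[simp] theorem md_stepS (q : ℕ) : (stepS q : Schema ℓ Δ (Head ℓ Δ N)).md = 0 := by
  unfold stepS; split_ifs <;> rfl
@[simp] theorem md_colourS (i : Fin Δ) (q : ℕ) :
    (colourS i q : Schema ℓ Δ (Head ℓ Δ N)).md = 0 := by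
  unfold colourS; split_ifs <;> rfl
@[simp] theorem md_parentS (i : Fin Δ) (q : ℕ) :
    (parentS i q : Schema ℓ Δ (Head ℓ Δ N)).md = 0 := by
  unfold parentS; split_ifs <;> rfl
@[simp] theorem md_indexS (i : Fin Δ) (q : ℕ) :
    (indexS i q : Schema ℓ Δ (Head ℓ Δ N)).md = 0 := by
  unfold indexS; split_ifs <;> rfl
@[simp] theorem md_codeS (k c : ℕ) : (codeS k c : Schema ℓ Δ (Head ℓ Δ N)).md = 0 := by
  unfold codeS; split_ifs <;> rfl
@[simp] theorem md_lastS : (lastS : Schema ℓ Δ (Head ℓ Δ N)).md = 0 := by simp [lastS]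
@[simp] theorem md_differS (i : Fin Δ) : (differS i : Schema ℓ Δ (Head ℓ Δ N)).md = 0 := by
  simp [differS]
@[simp] theorem md_fetchS (i : Fin Δ) (j : ℕ) :
    (fetchS i j : Schema ℓ Δ (Head ℓ Δ N)).md = 1 := by
  simp [fetchS]
@[simp] theorem md_shiftS (i : Fin Δ) (j : ℕ) :
    (shiftS i j : Schema ℓ Δ (Head ℓ Δ N)).md = 1 :=
  le_antisymm (Schema.md_table_le (by simp))
    (Schema.le_md_table (φ := .dia i .top) (by simp))
@[simp] theorem md_removeS (e : ℕ) (i : Fin Δ) (j : ℕ) :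
    (removeS e i j : Schema ℓ Δ (Head ℓ Δ N)).md = 1 := by
  refine le_antisymm (Schema.md_table_le (by simp)) ?_
  have := Schema.le_md_table (φ := (.dia i (parentS i 0) : Schema ℓ Δ (Head ℓ Δ N)))
    (l := [colourS i 0, colourS i 1, colourS i 2, parentS i 0, parentS i 1, parentS i 2,
      .dia i (parentS i 0), .dia i (parentS i 1), .dia i (parentS i 2)])
    (f := removeBit e j) (by simp)
  rwa [Schema.md_dia, md_parentS] at this
@[simp] theorem md_digitS (i d : ℕ) : (digitS i d : Schema ℓ Δ (Head ℓ Δ N)).md = 0 := by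
  unfold digitS bitS; split_ifs <;> simp
theorem md_freeS_le (a : Fin (Δ + 1)) : (freeS a : Schema ℓ Δ (Head ℓ Δ N)).md ≤ 1 :=
  Schema.md_conj_le (by simp)
theorem md_leastFreeS_le (a : Fin (Δ + 1)) :
    (leastFreeS a : Schema ℓ Δ (Head ℓ Δ N)).md ≤ 1 := by
  refine max_le (md_freeS_le a) (Schema.md_conj_le ?_)
  simp [md_freeS_le]
-- Exact depth 1 makes every greedy round a communication round, whether or not any node has its
-- turn.
theorem md_leastFreeS (hΔ : 1 ≤ Δ) (a : Fin (Δ + 1)) :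
    (leastFreeS a : Schema ℓ Δ (Head ℓ Δ N)).md = 1 := by
  refine le_antisymm (md_leastFreeS_le a) (le_max_of_le_left ?_)
  obtain ⟨d, rfl⟩ := Nat.exists_eq_add_of_le' hΔ
  simp [freeS, List.finRange_succ, Schema.conj]

theorem length_ringS_le (q : ℕ) : (ringS q : Schema ℓ Δ (Head ℓ Δ N)).length ≤ 2 := by
  unfold ringS; split_ifs <;> simp
theorem length_phaseS_le (q : ℕ) : (phaseS q : Schema ℓ Δ (Head ℓ Δ N)).length ≤ 2 := by
  unfold phaseS; split_ifs <;> simp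
theorem length_stepS_le (q : ℕ) : (stepS q : Schema ℓ Δ (Head ℓ Δ N)).length ≤ 2 := by
  unfold stepS; split_ifs <;> simp
theorem length_colourS_le (i : Fin Δ) (q : ℕ) :
    (colourS i q : Schema ℓ Δ (Head ℓ Δ N)).length ≤ 2 := by
  unfold colourS; split_ifs <;> simp
theorem length_parentS_le (i : Fin Δ) (q : ℕ) :
    (parentS i q : Schema ℓ Δ (Head ℓ Δ N)).length ≤ 2 := by
  unfold parentS; split_ifs <;> simp
theorem length_indexS_le (i : Fin Δ) (q : ℕ) :
    (indexS i q : Schema ℓ Δ (Head ℓ Δ N)).length ≤ 2 := by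
  unfold indexS; split_ifs <;> simp
theorem length_codeS_le (k c : ℕ) : (codeS k c : Schema ℓ Δ (Head ℓ Δ N)).length ≤ 2 := by
  unfold codeS; split_ifs <;> simp
theorem length_lastS_le : (lastS : Schema ℓ Δ (Head ℓ Δ N)).length ≤ 5 := by
  have h1 := length_ringS_le (ℓ := ℓ) (Δ := Δ) (N := N) (ℓ + 3)
  have h2 := length_phaseS_le (ℓ := ℓ) (Δ := Δ) (N := N) (N - 1)
  simp only [lastS, Schema.length_and]; omega
theorem length_differS_le (i : Fin Δ) :
    (differS i : Schema ℓ Δ (Head ℓ Δ N)).length ≤ 16 := by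
  have h1 := length_colourS_le (ℓ := ℓ) (N := N) i 0
  have h2 := length_parentS_le (ℓ := ℓ) (N := N) i 0
  simp only [differS, Schema.length_xor]; omega
theorem length_fetchS_le (i : Fin Δ) (j : ℕ) :
    (fetchS i j : Schema ℓ Δ (Head ℓ Δ N)).length ≤ 16 := by
  have h1 := length_colourS_le (ℓ := ℓ) (N := N) i j
  simp only [fetchS, Schema.length_or, Schema.length_neg, Schema.length_dia, Schema.length_top]
  omega
theorem length_shiftS_le (i : Fin Δ) (j : ℕ) :
    (shiftS i j : Schema ℓ Δ (Head ℓ Δ N)).length ≤ 1920 := by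
  have h1 := length_colourS_le (ℓ := ℓ) (N := N) i
  refine le_trans (Nat.le_add_right _ 13) (le_trans (Schema.length_table_le ?_) (by simp))
  simp only [List.mem_cons, List.not_mem_nil, or_false]
  rintro φ (rfl | rfl | rfl | rfl | rfl | rfl | rfl) <;>
    grind [Schema.length_dia, Schema.length_top]
theorem length_removeS_le (e : ℕ) (i : Fin Δ) (j : ℕ) :
    (removeS e i j : Schema ℓ Δ (Head ℓ Δ N)).length ≤ 7680 := by
  have h1 := length_colourS_le (ℓ := ℓ) (N := N) i
  have h2 := length_parentS_le (ℓ := ℓ) (N := N) i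
  refine le_trans (Nat.le_add_right _ 13) (le_trans (Schema.length_table_le ?_) (by simp))
  simp only [List.mem_cons, List.not_mem_nil, or_false]
  rintro φ (rfl | rfl | rfl | rfl | rfl | rfl | rfl | rfl | rfl) <;>
    grind [Schema.length_dia]
theorem length_digitS_le (i d : ℕ) : (digitS i d : Schema ℓ Δ (Head ℓ Δ N)).length ≤ 7 := by
  unfold digitS bitS
  split_ifs with h
  all_goals
    try have h1 := length_colourS_le (ℓ := ℓ) (N := N) ⟨i, h⟩ 0
    try have h2 := length_colourS_le (ℓ := ℓ) (N := N) ⟨i, h⟩ 1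
    simp only [Schema.length_and, Schema.length_neg, Schema.length_bot]
    omega
theorem length_freeS_le (a : Fin (Δ + 1)) :
    (freeS a : Schema ℓ Δ (Head ℓ Δ N)).length ≤ 4 * Δ + 1 := by
  refine (Schema.length_conj_le (c := 3) (by simp)).trans ?_
  simp
theorem length_leastFreeS_le (a : Fin (Δ + 1)) :
    (leastFreeS a : Schema ℓ Δ (Head ℓ Δ N)).length ≤ (4 * Δ + 3) * (Δ + 2) := by
  have h1 := length_freeS_le (ℓ := ℓ) (N := N) a
  have h2 : (((List.finRange (Δ + 1)).filter (· < a)).map fun b =>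
      (.neg (freeS b) : Schema ℓ Δ (Head ℓ Δ N))).length ≤ Δ + 1 := by
    rw [List.length_map]
    exact (List.length_filter_le _ _).trans (by simp)
  have h3 := Schema.length_conj_le (c := 4 * Δ + 2)
    (l := ((List.finRange (Δ + 1)).filter (· < a)).map fun b =>
      (.neg (freeS b) : Schema ℓ Δ (Head ℓ Δ N))) (by
      simp only [List.mem_map]
      rintro _ ⟨b, -, rfl⟩
      have := length_freeS_le (ℓ := ℓ) (N := N) b
      simp only [Schema.length_neg]; omega)
  have h4 := Nat.mul_le_mul_left (4 * Δ + 2 + 1) h2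
  simp only [leastFreeS, Schema.length_and]
  nlinarith

end Measures

/-- The colouring program. -/
def typedProgram (ℓ Δ N : ℕ) : TypedProgram ℓ Δ (Head ℓ Δ N) where
  terminal := terminal
  rule := rule
  attention := {.step ⟨3 ^ Δ + 6, by omega⟩}
  print := Finset.univ.map ⟨Head.palette, fun a b h => by injection h⟩
  md_terminal X := by cases X <;> simp only [terminal] <;> (try split_ifs) <;> rfl
  md_condition X b hb := by
    cases X <;> simp only [rule, List.not_mem_nil, List.mem_cons, or_false] at hb
    · rcases hb with rfl | rfl | rfl | rfl | rfl | rfl | rfl <;> simp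
    · rcases hb with rfl | rfl | rfl | rfl <;> simp
    · rcases hb with rfl | rfl <;> simp
    · rcases hb with rfl | rfl <;> simp
  md_consequence X b hb := by
    cases X <;> simp only [rule, List.not_mem_nil, List.mem_cons, or_false] at hb
    · rcases hb with rfl | rfl | rfl | rfl | rfl | rfl | rfl <;> simp <;> split_ifs <;> simp
    · rcases hb with rfl | rfl | rfl | rfl <;> simp
    · rcases hb with rfl | rfl <;> simp
    · rcases hb with rfl | rfl <;> simp [md_leastFreeS_le]
  md_backup X := by
    cases X <;> simp only [rule] <;> (try split_ifs) <;> (try simp)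
    · exact Schema.md_disj_le (by simp)
    · exact Schema.md_conj_le (by simp)

end Colouring
end MPMSC

/-! ### Number of heads and size of the program. -/

namespace MPMSC
namespace Colouring

variable {ℓ Δ N : ℕ}

/-- The size of the clauses of a head. -/
def headSize (X : Head ℓ Δ N) : ℕ := (1 + (terminal X).length) + (1 + (rule X).length)

theorem length_terminal_le (X : Head ℓ Δ N) : (terminal X).length ≤ 2 := by
  cases X <;> simp only [terminal] <;> (try split_ifs) <;> simp

theorem headSize_ring_le (q : Fin (ℓ + 4)) : headSize (.ring q : Head ℓ Δ N) ≤ 6 := by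
  have h0 := length_terminal_le (.ring q : Head ℓ Δ N)
  have h1 := length_ringS_le (ℓ := ℓ) (Δ := Δ) (N := N)
  have h2 : (rule (.ring q : Head ℓ Δ N)).length ≤ 2 := by
    simp only [rule, Rule.length]; split_ifs <;> simp [h1]
  unfold headSize; omega

theorem headSize_phase_le (p : Fin N) : headSize (.phase p : Head ℓ Δ N) ≤ 18 := by
  have h0 := length_terminal_le (.phase p : Head ℓ Δ N)
  have h1 := length_ringS_le (ℓ := ℓ) (Δ := Δ) (N := N) (ℓ + 3)
  have h2 := length_phaseS_le (ℓ := ℓ) (Δ := Δ) (N := N) (p - 1)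
  have h3 : (rule (.phase p : Head ℓ Δ N)).length ≤ 14 := by
    simp only [rule, Rule.length]
    split_ifs <;> simp only [List.map_nil, List.sum_nil, Schema.length_ite, Schema.length_bot,
      Schema.length_var] <;> omega
  unfold headSize; omega

theorem headSize_reducing_le : headSize (.reducing : Head ℓ Δ N) ≤ 12 := by
  have h0 := length_terminal_le (.reducing : Head ℓ Δ N)
  have h1 := length_lastS_le (ℓ := ℓ) (Δ := Δ) (N := N)
  simp only [headSize, rule, Rule.length, List.map_nil, List.sum_nil, Schema.length_and,
    Schema.length_neg, Schema.length_var]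
  omega

theorem headSize_step_le (k : Fin (3 ^ Δ + 7)) : headSize (.step k : Head ℓ Δ N) ≤ 9 := by
  have h0 := length_terminal_le (.step k : Head ℓ Δ N)
  have h1 := length_lastS_le (ℓ := ℓ) (Δ := Δ) (N := N)
  have h2 := length_stepS_le (ℓ := ℓ) (Δ := Δ) (N := N) (k - 1)
  have h3 : (rule (.step k : Head ℓ Δ N)).length ≤ 5 := by
    simp only [rule, Rule.length, List.map_nil, List.sum_nil]
    split_ifs <;> omega
  unfold headSize; omega

theorem headSize_greedy_le : headSize (.greedy : Head ℓ Δ N) ≤ 15 := by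
  have h0 := length_terminal_le (.greedy : Head ℓ Δ N)
  have h1 := length_stepS_le (ℓ := ℓ) (Δ := Δ) (N := N) (6 + Δ)
  have h2 := length_stepS_le (ℓ := ℓ) (Δ := Δ) (N := N) (5 + 3 ^ Δ)
  simp only [headSize, rule, Rule.length, List.map_nil, List.sum_nil, Schema.length_and,
    Schema.length_or, Schema.length_neg, Schema.length_var]
  omega

theorem headSize_turn_le : headSize (.turn : Head ℓ Δ N) ≤ 9 * 3 ^ Δ + 6 := by
  have h0 := length_terminal_le (.turn : Head ℓ Δ N)
  have h1 := Schema.length_disj_le (c := 5)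
    (l := (List.range (3 ^ Δ - (Δ + 1))).map fun r =>
      (.and (stepS (6 + Δ + r)) (codeS Δ (Δ + 1 + r)) : Schema ℓ Δ (Head ℓ Δ N))) (by
      simp only [List.mem_map]
      rintro _ ⟨r, -, rfl⟩
      have h1 := length_stepS_le (ℓ := ℓ) (Δ := Δ) (N := N) (6 + Δ + r)
      have h2 := length_codeS_le (ℓ := ℓ) (Δ := Δ) (N := N) Δ (Δ + 1 + r)
      simp only [Schema.length_and]; omega)
  rw [List.length_map, List.length_range] at h1
  simp only [headSize, rule, Rule.length, List.map_nil, List.sum_nil]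
  omega

theorem headSize_colour_le (i : Fin Δ) (j : Fin (ℓ + 2)) :
    headSize (.colour i j : Head ℓ Δ N) ≤ 23084 := by
  have h0 := length_terminal_le (.colour i j : Head ℓ Δ N)
  have h1 := length_ringS_le (ℓ := ℓ) (Δ := Δ) (N := N) 0
  have h2 := length_ringS_le (ℓ := ℓ) (Δ := Δ) (N := N) (ℓ + 3)
  have h3 := length_stepS_le (ℓ := ℓ) (Δ := Δ) (N := N) 1
  have h4 := length_stepS_le (ℓ := ℓ) (Δ := Δ) (N := N) 3
  have h5 := length_stepS_le (ℓ := ℓ) (Δ := Δ) (N := N) 5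
  have h6 := length_removeS_le (ℓ := ℓ) (Δ := Δ) (N := N) 5 i j
  have h7 := length_removeS_le (ℓ := ℓ) (Δ := Δ) (N := N) 4 i j
  have h8 := length_removeS_le (ℓ := ℓ) (Δ := Δ) (N := N) 3 i j
  have h9 := length_differS_le (ℓ := ℓ) (Δ := Δ) (N := N) i
  have h10 := length_colourS_le (ℓ := ℓ) (Δ := Δ) (N := N) i (j + 1)
  have h11 : (if (j : ℕ) = 0 then colourS i 0 else indexS i (j - 1) :
      Schema ℓ Δ (Head ℓ Δ N)).length ≤ 2 := by
    split_ifs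
    · exact length_colourS_le _ _
    · exact length_indexS_le _ _
  simp only [headSize, rule, Rule.length, List.map_cons, List.map_nil, List.sum_cons, List.sum_nil,
    Schema.length_and, Schema.length_var]
  omega

theorem headSize_parent_le (i : Fin Δ) (j : Fin (ℓ + 2)) :
    headSize (.parent i j : Head ℓ Δ N) ≤ 2000 := by
  have h0 := length_terminal_le (.parent i j : Head ℓ Δ N)
  have h1 := length_ringS_le (ℓ := ℓ) (Δ := Δ) (N := N) 0
  have h3 := length_stepS_le (ℓ := ℓ) (Δ := Δ) (N := N) 0
  have h4 := length_stepS_le (ℓ := ℓ) (Δ := Δ) (N := N) 2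
  have h5 := length_stepS_le (ℓ := ℓ) (Δ := Δ) (N := N) 4
  have h6 := length_shiftS_le (ℓ := ℓ) (Δ := Δ) (N := N) i j
  have h7 := length_fetchS_le (ℓ := ℓ) (Δ := Δ) (N := N) i j
  have h9 := length_differS_le (ℓ := ℓ) (Δ := Δ) (N := N) i
  have h10 := length_parentS_le (ℓ := ℓ) (Δ := Δ) (N := N) i (j + 1)
  simp only [headSize, rule, Rule.length, List.map_cons, List.map_nil, List.sum_cons, List.sum_nil,
    Schema.length_and, Schema.length_or, Schema.length_var]
  omega

theorem headSize_index_le (i : Fin Δ) (j : Fin (bitLog (ℓ + 2))) :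
    headSize (.index i j : Head ℓ Δ N) ≤ 40 + 6 * bitLog (ℓ + 2) := by
  have h0 := length_terminal_le (.index i j : Head ℓ Δ N)
  have h1 := length_ringS_le (ℓ := ℓ) (Δ := Δ) (N := N) 0
  have h2 := length_differS_le (ℓ := ℓ) (Δ := Δ) (N := N) i
  have h3 := Schema.length_conj_le (c := 2)
    (l := (List.range j).map fun a => (indexS i a : Schema ℓ Δ (Head ℓ Δ N))) (by
      simp only [List.mem_map]
      rintro _ ⟨r, -, rfl⟩
      exact length_indexS_le _ _)
  rw [List.length_map, List.length_range] at h3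
  have h4 := j.isLt
  simp only [headSize, rule, Rule.length, List.map_cons, List.map_nil, List.sum_cons, List.sum_nil,
    Schema.length_xor, Schema.length_bot, Schema.length_var]
  omega

theorem headSize_code_le (k : Fin (Δ + 1)) (c : Fin (3 ^ (k : ℕ))) :
    headSize (.code k c : Head ℓ Δ N) ≤ 14 := by
  have h0 := length_terminal_le (.code k c : Head ℓ Δ N)
  have h1 := length_codeS_le (ℓ := ℓ) (Δ := Δ) (N := N) (k - 1) (c / 3)
  have h2 := length_digitS_le (ℓ := ℓ) (Δ := Δ) (N := N) (k - 1) (c % 3)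
  have h3 : (rule (.code k c : Head ℓ Δ N)).length ≤ 10 := by
    simp only [rule, Rule.length, List.map_nil, List.sum_nil]
    split_ifs <;> simp only [Schema.length_top, Schema.length_and] <;> omega
  unfold headSize; omega

theorem headSize_palette_le (a : Fin (Δ + 1)) :
    headSize (.palette a : Head ℓ Δ N) ≤ (4 * Δ + 3) * (Δ + 2) + 20 := by
  have h0 := length_terminal_le (.palette a : Head ℓ Δ N)
  have h1 := length_stepS_le (ℓ := ℓ) (Δ := Δ) (N := N) (6 + Δ)
  have h2 := length_codeS_le (ℓ := ℓ) (Δ := Δ) (N := N) Δ a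
  have h3 := length_leastFreeS_le (ℓ := ℓ) (Δ := Δ) (N := N) a
  simp only [headSize, rule, Rule.length, List.map_cons, List.map_nil, List.sum_cons, List.sum_nil,
    Schema.length_ite, Schema.length_var]
  omega

theorem sum_three_pow_le (d : ℕ) : ∑ k : Fin (d + 1), 3 ^ (k : ℕ) ≤ 2 * 3 ^ d := by
  rw [Fin.sum_univ_eq_sum_range (fun k => 3 ^ k)]
  induction d with
  | zero => simp
  | succ d ih => rw [Finset.sum_range_succ, pow_succ]; omega

theorem heads_le (hℓ : 1 ≤ ℓ) (hΔ : 1 ≤ Δ) (hN : N ≤ ℓ + 6) :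
    (typedProgram ℓ Δ N).toProgram.heads ≤ 40 * (Δ * ℓ + 3 ^ Δ) := by
  have hc : (typedProgram ℓ Δ N).toProgram.heads = ∑ _X : Head ℓ Δ N, 1 := by
    simp [TypedProgram.toProgram]
  have hs := sum_three_pow_le Δ
  have hz := bitLog_le_self (w := ℓ + 2) (by omega)
  rw [hc, Head.sum_eq]
  simp only [Finset.sum_const, Finset.card_univ, Fintype.card_fin, smul_eq_mul, mul_one]
  have h1 : ℓ ≤ Δ * ℓ := Nat.le_mul_of_pos_left _ hΔ
  have h2 : Δ ≤ Δ * ℓ := Nat.le_mul_of_pos_right _ hℓ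
  have h3 : Δ * (ℓ + 2) = Δ * ℓ + 2 * Δ := by ring
  have h4 := Nat.mul_le_mul_left Δ hz
  have h5 : 1 ≤ 3 ^ Δ := Nat.one_le_pow _ _ (by norm_num)
  omega

theorem size_le (hℓ : 1 ≤ ℓ) (hΔ : 1 ≤ Δ) (hN : N ≤ ℓ + 6) :
    (typedProgram ℓ Δ N).toProgram.size ≤ 100000 * (Δ ^ 2 * ℓ + 3 ^ Δ) := by
  have hc : (typedProgram ℓ Δ N).toProgram.size = ∑ X : Head ℓ Δ N, headSize X :=
    TypedProgram.size_toProgram _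
  have hs := sum_three_pow_le Δ
  have hz := bitLog_le_self (w := ℓ + 2) (by omega)
  have hz2 := bitLog_sq_le (w := ℓ + 2) (by omega)
  rw [hc, Head.sum_eq]
  have b1 := Finset.sum_le_sum fun q (_ : q ∈ Finset.univ) =>
    headSize_ring_le (ℓ := ℓ) (Δ := Δ) (N := N) q
  have b2 := Finset.sum_le_sum fun q (_ : q ∈ Finset.univ) =>
    headSize_phase_le (ℓ := ℓ) (Δ := Δ) (N := N) q
  have b3 := headSize_reducing_le (ℓ := ℓ) (Δ := Δ) (N := N)
  have b4 := Finset.sum_le_sum fun q (_ : q ∈ Finset.univ) =>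
    headSize_step_le (ℓ := ℓ) (Δ := Δ) (N := N) q
  have b5 := headSize_greedy_le (ℓ := ℓ) (Δ := Δ) (N := N)
  have b6 := headSize_turn_le (ℓ := ℓ) (Δ := Δ) (N := N)
  have b7 := Finset.sum_le_sum fun i (_ : i ∈ Finset.univ) =>
    Finset.sum_le_sum fun j (_ : j ∈ Finset.univ) =>
      headSize_colour_le (ℓ := ℓ) (Δ := Δ) (N := N) i j
  have b8 := Finset.sum_le_sum fun i (_ : i ∈ Finset.univ) =>
    Finset.sum_le_sum fun j (_ : j ∈ Finset.univ) =>
      headSize_parent_le (ℓ := ℓ) (Δ := Δ) (N := N) i j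
  have b9 := Finset.sum_le_sum fun i (_ : i ∈ Finset.univ) =>
    Finset.sum_le_sum fun j (_ : j ∈ Finset.univ) =>
      headSize_index_le (ℓ := ℓ) (Δ := Δ) (N := N) i j
  have b10 := Finset.sum_le_sum fun i (_ : i ∈ Finset.univ) =>
    Finset.sum_le_sum fun j (_ : j ∈ Finset.univ) =>
      headSize_code_le (ℓ := ℓ) (Δ := Δ) (N := N) i j
  have b11 := Finset.sum_le_sum fun q (_ : q ∈ Finset.univ) =>
    headSize_palette_le (ℓ := ℓ) (Δ := Δ) (N := N) q
  simp only [Finset.sum_const, Finset.card_univ, Fintype.card_fin, smul_eq_mul, ← Finset.sum_mul]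
    at b1 b2 b3 b4 b5 b6 b7 b8 b9 b10 b11
  -- The sum over the heads is of order Δℓ + 3^Δ, so Δ²ℓ is more than is needed.
  have h0 : Δ ≤ Δ ^ 2 := Nat.le_self_pow (by norm_num) _
  have h1 : Δ * ℓ ≤ Δ ^ 2 * ℓ := Nat.mul_le_mul_right _ h0
  have h2 : ℓ ≤ Δ * ℓ := Nat.le_mul_of_pos_left _ hΔ
  have h3 : Δ ≤ Δ * ℓ := Nat.le_mul_of_pos_right _ hℓ
  have h4 : Δ * ((ℓ + 2) * 23084) = 23084 * (Δ * ℓ) + 46168 * Δ := by ring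
  have h5 : Δ * ((ℓ + 2) * 2000) = 2000 * (Δ * ℓ) + 4000 * Δ := by ring
  -- The counters: 64 = 40 + 6 · 4, from b ≤ ℓ + 2 and b² ≤ 4(ℓ + 2) for b = `bitLog (ℓ + 2)`.
  have h6 : Δ * (bitLog (ℓ + 2) * (40 + 6 * bitLog (ℓ + 2))) ≤ 64 * (Δ * ℓ) + 128 * Δ := by
    have : bitLog (ℓ + 2) * (40 + 6 * bitLog (ℓ + 2)) ≤ 64 * (ℓ + 2) := by nlinarith
    refine (Nat.mul_le_mul_left Δ this).trans (le_of_eq (by ring))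
  have h7 : (Δ + 1) * ((4 * Δ + 3) * (Δ + 2) + 20) ≤ 42 * Δ ^ 3 + 40 * Δ := by
    have e1 : (Δ + 1) * ((4 * Δ + 3) * (Δ + 2)) ≤ (2 * Δ) * ((7 * Δ) * (3 * Δ)) :=
      Nat.mul_le_mul (by omega) (Nat.mul_le_mul (by omega) (by omega))
    nlinarith
  have h8 := cube_le_three_pow Δ
  have h9 : 1 ≤ 3 ^ Δ := Nat.one_le_pow _ _ (by norm_num)
  omega

end Colouring
end MPMSC

namespace MPMSC

/-! ### Neighbours and identifiers -/

namespace KripkeModel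

variable {ℓ : ℕ} {W : Type u} {M : KripkeModel ℓ W} {Δ : ℕ}

/-- A smaller identifier would make the set of preceding neighbours strictly smaller, so equal ranks
force equal identifiers. -/
theorem IsNeighbour.eq (hM : M.IsGraphModel Δ) {w v v' : W} {i : ℕ} (h : M.IsNeighbour w i v)
    (h' : M.IsNeighbour w i v') : v = v' := by
  have := hM.finite
  have key : ∀ v v' : W, M.IsNeighbour w i v → M.IsNeighbour w i v' →
      ¬ M.ident v < M.ident v' := by
    intro v v' h h' hlt
    have hss : {x | M.R w x ∧ M.ident x < M.ident v} ⊂ {x | M.R w x ∧ M.ident x < M.ident v'} := by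
      refine ⟨fun x hx => ⟨hx.1, hx.2.trans hlt⟩, fun hsub => ?_⟩
      have : v ∈ {x | M.R w x ∧ M.ident x < M.ident v} := hsub ⟨h.1, hlt⟩
      exact lt_irrefl _ this.2
    have := Set.ncard_lt_ncard hss (Set.toFinite _)
    rw [h.2, h'.2] at this
    exact lt_irrefl _ this
  have h1 := key v v' h h'
  have h2 := key v' v h' h
  exact hM.ident_injective (by omega)

/-- The neighbours preceding `v` do not include `v`, so its rank is below the degree. This is how
each edge appears in one of the Δ functional graphs. -/
theorem exists_isNeighbour (hM : M.IsGraphModel Δ) {w v : W} (h : M.R w v) :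
    ∃ i : Fin Δ, M.IsNeighbour w i v := by
  have := hM.finite
  have hss : {x | M.R w x ∧ M.ident x < M.ident v} ⊂ {x | M.R w x} :=
    ⟨fun x hx => hx.1, fun hsub => lt_irrefl _ (hsub (show v ∈ {x | M.R w x} from h)).2⟩
  have hlt := (Set.ncard_lt_ncard hss (Set.toFinite _)).trans_le (hM.degree_le w)
  exact ⟨⟨_, hlt⟩, h, rfl⟩

theorem exists_isNeighbour_and_iff (hM : M.IsGraphModel Δ) {w v : W} {i : ℕ}
    (h : M.IsNeighbour w i v) (p : W → Prop) : (∃ u, M.IsNeighbour w i u ∧ p u) ↔ p v :=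
  ⟨fun ⟨_, hu, hp⟩ => IsNeighbour.eq hM hu h ▸ hp, fun hp => ⟨v, h, hp⟩⟩

end KripkeModel

theorem testBit_sum_two_pow {n : ℕ} (b : Fin n → Prop) [DecidablePred b] (j : ℕ) :
    (∑ i : Fin n, if b i then 2 ^ (i : ℕ) else 0).testBit j = true ↔ ∃ h : j < n, b ⟨j, h⟩ := by
  induction n generalizing j with
  | zero => simp
  | succ n ih =>
    have hsum : (∑ i : Fin (n + 1), if b i then 2 ^ (i : ℕ) else 0) =
        (if b 0 then 1 else 0) + 2 * ∑ i : Fin n, if b i.succ then 2 ^ (i : ℕ) else 0 := by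
      rw [Fin.sum_univ_succ, Finset.mul_sum]
      congr 1
      refine Finset.sum_congr rfl fun i _ => ?_
      split_ifs <;> simp [pow_succ, mul_comm]
    rw [hsum]
    rcases j with _ | j
    · rw [Nat.testBit_zero]
      split_ifs with h
      · simpa [Nat.add_mod] using h
      · simpa [Nat.add_mod] using h
    · rw [Nat.testBit_succ, show ((if b 0 then 1 else 0) +
        2 * ∑ i : Fin n, if b i.succ then 2 ^ (i : ℕ) else 0) / 2 =
        ∑ i : Fin n, if b i.succ then 2 ^ (i : ℕ) else 0 by split_ifs <;> omega,
        ih (fun i => b i.succ)]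
      simp

theorem KripkeModel.testBit_ident {ℓ : ℕ} {W : Type u} (M : KripkeModel ℓ W) (w : W) (j : ℕ) :
    (M.ident w).testBit j = true ↔ ∃ h : j < ℓ, w ∈ M.V ⟨j, h⟩ := by
  classical
  exact testBit_sum_two_pow (fun i => w ∈ M.V i) j

theorem KripkeModel.ident_lt {ℓ : ℕ} {W : Type u} (M : KripkeModel ℓ W) (w : W) :
    M.ident w < 2 ^ ℓ := by
  refine Nat.lt_pow_two_of_testBit _ fun j hj => ?_
  rw [Bool.eq_false_iff, Ne, M.testBit_ident]
  rintro ⟨h, -⟩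
  omega

/-! ### The clock -/

theorem add_one_mod_eq {t L : ℕ} (hL : 0 < L) :
    (t + 1) % L = if t % L + 1 = L then 0 else t % L + 1 := by
  have h1 := Nat.mod_lt t hL
  split_ifs with h
  · exact Nat.mod_eq_zero_of_dvd ⟨t / L + 1, by have := Nat.div_add_mod t L; rw [mul_add]; omega⟩
  · rw [← Nat.mod_add_mod]
    exact Nat.mod_eq_of_lt (by omega)

theorem add_one_div_eq {t L : ℕ} (hL : 0 < L) :
    (t + 1) / L = if t % L + 1 = L then t / L + 1 else t / L := by
  have h1 := Nat.mod_lt t hL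
  have h2 := Nat.div_add_mod t L
  split_ifs with h
  · refine Nat.div_eq_of_lt_le ?_ ?_ <;> nlinarith
  · rw [Nat.div_eq_iff hL]
    have : L * (t / L) = t / L * L := mul_comm _ _
    omega

namespace Colouring

variable {ℓ Δ N : ℕ} {W : Type u} (M : KripkeModel ℓ W)

variable (Δ N) in
/-- The configurations of the colouring program. -/
noncomputable def cfg (t : ℕ) : W → Head ℓ Δ N → Prop := (typedProgram ℓ Δ N).config M t

theorem cfg_zero (w : W) (X : Head ℓ Δ N) :
    cfg Δ N M 0 w X ↔ (terminal X).Holds M (fun _ e => e.elim) w := Iff.rfl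

theorem cfg_succ (t : ℕ) (w : W) (X : Head ℓ Δ N) :
    cfg Δ N M (t + 1) w X ↔
      ((rule X).hotBody M (cfg Δ N M t) w).Holds M (cfg Δ N M t) w := Iff.rfl

theorem cfg_ring (t : ℕ) (w : W) (q : Fin (ℓ + 4)) :
    cfg Δ N M t w (.ring q) ↔ t % (ℓ + 4) = q := by
  induction t generalizing q with
  | zero =>
    rw [cfg_zero, terminal, Nat.zero_mod]
    split_ifs with h
    · simp [h]
    · simpa using Ne.symm h
  | succ t ih =>
    have hq := q.isLt
    have hlt := Nat.mod_lt t (show 0 < ℓ + 4 by omega)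
    rw [cfg_succ, add_one_mod_eq (by omega)]
    simp only [rule, Rule.hotBody, Rule.select]
    by_cases h : (q : ℕ) = 0
    · simp only [h, if_true, ringS, show ℓ + 3 < ℓ + 4 by omega, dif_pos, Schema.holds_var, ih]
      grind
    · simp only [h, if_false, ringS, show (q : ℕ) - 1 < ℓ + 4 by omega, dif_pos,
        Schema.holds_var, ih]
      split_ifs <;> omega

theorem holds_ringS (t : ℕ) (w : W) {q : ℕ} (hq : q < ℓ + 4) :
    (ringS q : Schema ℓ Δ (Head ℓ Δ N)).Holds M (cfg Δ N M t) w ↔ t % (ℓ + 4) = q := by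
  simp [ringS, hq, cfg_ring]

theorem cfg_phase (t : ℕ) (w : W) (p : Fin N) :
    cfg Δ N M t w (.phase p) ↔ t / (ℓ + 4) = p := by
  induction t generalizing p with
  | zero =>
    rw [cfg_zero, terminal, Nat.zero_div]
    split_ifs with h
    · simp [h]
    · simpa using Ne.symm h
  | succ t ih =>
    have hp := p.isLt
    rw [cfg_succ, add_one_div_eq (by omega)]
    simp only [rule, Rule.hotBody, Rule.select, Schema.holds_ite, Schema.holds_var,
      holds_ringS M t w (show ℓ + 3 < ℓ + 4 by omega), ih]
    by_cases h : (p : ℕ) = 0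
    · simp only [h, if_true, Schema.holds_bot]
      grind
    · simp only [h, if_false, phaseS, show (p : ℕ) - 1 < N by omega, dif_pos,
        Schema.holds_var, ih]
      split_ifs <;> omega

theorem holds_lastS (hN : 1 ≤ N) (t : ℕ) (w : W) :
    (lastS : Schema ℓ Δ (Head ℓ Δ N)).Holds M (cfg Δ N M t) w ↔ t + 1 = (ℓ + 4) * N := by
  simp only [lastS, Schema.holds_and, holds_ringS M t w (show ℓ + 3 < ℓ + 4 by omega), phaseS,
    show N - 1 < N by omega, dif_pos, Schema.holds_var, cfg_phase]
  have h1 := Nat.div_add_mod t (ℓ + 4)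
  have h2 := Nat.mod_lt t (show 0 < ℓ + 4 by omega)
  obtain ⟨m, rfl⟩ := Nat.exists_eq_add_of_le' hN
  constructor
  · rintro ⟨h3, h4⟩
    rw [h3, h4, Nat.add_sub_cancel] at h1
    rw [mul_add]; omega
  · intro h
    have hd : (t + 1) / (ℓ + 4) = m + 1 := by rw [h]; simp
    have hm : (t + 1) % (ℓ + 4) = 0 := by rw [h]; simp
    rw [add_one_div_eq (by omega)] at hd
    rw [add_one_mod_eq (by omega)] at hm
    split_ifs at hd hm
    omega

theorem cfg_reducing (hN : 1 ≤ N) (t : ℕ) (w : W) :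
    cfg Δ N M t w .reducing ↔ t < (ℓ + 4) * N := by
  induction t with
  | zero =>
    have : 0 < (ℓ + 4) * N := by positivity
    rw [cfg_zero, terminal]
    exact iff_of_true trivial this
  | succ t ih =>
    rw [cfg_succ]
    simp only [rule, Rule.hotBody, Rule.select, Schema.holds_and, Schema.holds_var,
      Schema.holds_neg, holds_lastS M hN, ih]
    omega

theorem cfg_step (hN : 1 ≤ N) (t : ℕ) (w : W) (k : Fin (3 ^ Δ + 7)) :
    cfg Δ N M t w (.step k) ↔ t = (ℓ + 4) * N + k := by
  have hpos : 0 < (ℓ + 4) * N := by positivity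
  induction t generalizing k with
  | zero =>
    rw [cfg_zero, terminal]
    · simp only [Schema.holds_bot, false_iff]; omega
    all_goals simp
  | succ t ih =>
    have hk := k.isLt
    rw [cfg_succ]
    simp only [rule, Rule.hotBody, Rule.select]
    by_cases h : (k : ℕ) = 0
    · simp only [h, if_true, holds_lastS M hN]
      omega
    · simp only [h, if_false, stepS, show (k : ℕ) - 1 < 3 ^ Δ + 7 by omega, dif_pos,
        Schema.holds_var, ih]
      omega

theorem holds_stepS (hN : 1 ≤ N) (t : ℕ) (w : W) {k : ℕ} (hk : k < 3 ^ Δ + 7) :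
    (stepS k : Schema ℓ Δ (Head ℓ Δ N)).Holds M (cfg Δ N M t) w ↔ t = (ℓ + 4) * N + k := by
  simp [stepS, hk, cfg_step M hN]

theorem cfg_greedy (hN : 1 ≤ N) (hΔ : 1 ≤ Δ) (t : ℕ) (w : W) :
    cfg Δ N M t w .greedy ↔
      (ℓ + 4) * N + (6 + Δ) < t ∧ t < (ℓ + 4) * N + (6 + 3 ^ Δ) := by
  have hlt := succ_lt_three_pow hΔ
  induction t with
  | zero =>
    rw [cfg_zero, terminal]
    · simp
    all_goals simp
  | succ t ih =>
    rw [cfg_succ]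
    simp only [rule, Rule.hotBody, Rule.select, Schema.holds_and, Schema.holds_or,
      Schema.holds_var, Schema.holds_neg, ih,
      holds_stepS M hN t w (show 6 + Δ < 3 ^ Δ + 7 by omega),
      holds_stepS M hN t w (show 5 + 3 ^ Δ < 3 ^ Δ + 7 by omega)]
    omega

/-! ### Registers -/

/-- The schemata `S 0, S 1, …` are the bits of `x` at `w`. -/
def Reads (S : ℕ → Schema ℓ Δ (Head ℓ Δ N)) (t : ℕ) (w : W) (x : ℕ) : Prop :=
  ∀ j, (S j).Holds M (cfg Δ N M t) w ↔ x.testBit j = true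

theorem reads_colourS {t : ℕ} {w : W} {i : Fin Δ} {x : ℕ} (hx : x < 2 ^ (ℓ + 2))
    (h : ∀ j, cfg Δ N M t w (.colour i j) ↔ x.testBit j = true) :
    Reads (N := N) M (colourS i) t w x := by
  intro j
  unfold colourS
  split_ifs with hj
  · exact h ⟨j, hj⟩
  · simp [Nat.testBit_eq_false_of_lt (hx.trans_le (Nat.pow_le_pow_right (by norm_num)
      (show ℓ + 2 ≤ j by omega)))]

theorem reads_parentS {t : ℕ} {w : W} {i : Fin Δ} {x : ℕ} (hx : x < 2 ^ (ℓ + 2))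
    (h : ∀ j, cfg Δ N M t w (.parent i j) ↔ x.testBit j = true) :
    Reads (N := N) M (parentS i) t w x := by
  intro j
  unfold parentS
  split_ifs with hj
  · exact h ⟨j, hj⟩
  · simp [Nat.testBit_eq_false_of_lt (hx.trans_le (Nat.pow_le_pow_right (by norm_num)
      (show ℓ + 2 ≤ j by omega)))]

theorem reads_indexS {t : ℕ} {w : W} {i : Fin Δ} {x : ℕ} (hx : x < 2 ^ (bitLog (ℓ + 2)))
    (h : ∀ j, cfg Δ N M t w (.index i j) ↔ x.testBit j = true) :
    Reads (N := N) M (indexS i) t w x := by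
  intro j
  unfold indexS
  split_ifs with hj
  · exact h ⟨j, hj⟩
  · simp [Nat.testBit_eq_false_of_lt (hx.trans_le (Nat.pow_le_pow_right (by norm_num)
      (show bitLog (ℓ + 2) ≤ j by omega)))]

variable {M}

theorem Reads.colour {t : ℕ} {w : W} {i : Fin Δ} {x : ℕ} (h : Reads (N := N) M (colourS i) t w x)
    (j : Fin (ℓ + 2)) : cfg Δ N M t w (.colour i j) ↔ x.testBit j = true := by
  simpa [colourS] using h j

theorem Reads.parent {t : ℕ} {w : W} {i : Fin Δ} {x : ℕ} (h : Reads (N := N) M (parentS i) t w x)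
    (j : Fin (ℓ + 2)) : cfg Δ N M t w (.parent i j) ↔ x.testBit j = true := by
  simpa [parentS] using h j

theorem Reads.index {t : ℕ} {w : W} {i : Fin Δ} {x : ℕ} (h : Reads (N := N) M (indexS i) t w x)
    (j : Fin (bitLog (ℓ + 2))) : cfg Δ N M t w (.index i j) ↔ x.testBit j = true := by
  simpa [indexS] using h j

theorem holds_differS {t : ℕ} {w : W} {i : Fin Δ} {x y : ℕ}
    (hx : Reads (N := N) M (colourS i) t w x) (hy : Reads (N := N) M (parentS i) t w y) :
    (differS i : Schema ℓ Δ (Head ℓ Δ N)).Holds M (cfg Δ N M t) w ↔ ¬ x % 2 = y % 2 := by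
  simp only [differS, Schema.holds_xor, hx 0, hy 0, Nat.testBit_zero, decide_eq_true_eq]
  omega

/-! ### One colour reduction step -/

/-- A middle round of a phase performs one step of the serial search on the three registers; the
bound on the new count excludes an overflow of the counter. -/
theorem scan_step {t : ℕ} {w : W} {i : Fin Δ} {x y z : ℕ} (hN : 1 ≤ N) (ht : t < (ℓ + 4) * N)
    (h0 : t % (ℓ + 4) ≠ 0) (hlast : t % (ℓ + 4) ≠ ℓ + 3)
    (hxlt : x < 2 ^ (ℓ + 2)) (hylt : y < 2 ^ (ℓ + 2))
    (hzlt : (scanStep (x, y, z)).2.2 < 2 ^ bitLog (ℓ + 2))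
    (hx : Reads (N := N) M (colourS i) t w x) (hy : Reads (N := N) M (parentS i) t w y)
    (hz : Reads (N := N) M (indexS i) t w z) :
    Reads (N := N) M (colourS i) (t + 1) w (scanStep (x, y, z)).1 ∧
    Reads (N := N) M (parentS i) (t + 1) w (scanStep (x, y, z)).2.1 ∧
    Reads (N := N) M (indexS i) (t + 1) w (scanStep (x, y, z)).2.2 := by
  have hr := (cfg_reducing (Δ := Δ) M hN t w).2 ht
  have e0 := holds_ringS (Δ := Δ) (N := N) M t w (show 0 < ℓ + 4 by omega)
  have e3 := holds_ringS (Δ := Δ) (N := N) M t w (show ℓ + 3 < ℓ + 4 by omega)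
  have ed := holds_differS hx hy
  by_cases hd : x % 2 = y % 2
  · simp only [scanStep, hd, if_true] at hzlt ⊢
    refine ⟨reads_colourS M (by omega) fun j => ?_, reads_parentS M (by omega) fun j => ?_,
      reads_indexS M hzlt fun j => ?_⟩
    · rw [cfg_succ]
      simp only [rule, Rule.hotBody, Rule.select, Schema.holds_and, Schema.holds_var, hr, e0, e3,
        ed, h0, hlast, hd, not_true_eq_false, and_false, if_false, if_true, hx (j + 1),
        Nat.testBit_succ]
    · rw [cfg_succ]
      simp only [rule, Rule.hotBody, Rule.select, Schema.holds_and, Schema.holds_var, hr, e0,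
        ed, h0, hd, not_true_eq_false, and_false, if_false, if_true, hy (j + 1),
        Nat.testBit_succ]
    · rw [cfg_succ]
      simp only [rule, Rule.hotBody, Rule.select, Schema.holds_var, e0, Schema.holds_xor,
        ed, h0, hd, not_true_eq_false, if_false, hz.index j, Schema.holds_conj, List.mem_map,
        List.mem_range, forall_exists_index, and_imp, forall_apply_eq_imp_iff₂, hz _,
        testBit_add_one, Bool.not_eq_true]
  · simp only [scanStep, hd, if_false] at hzlt ⊢
    refine ⟨reads_colourS M hxlt fun j => ?_, reads_parentS M hylt fun j => ?_,
      reads_indexS M hzlt fun j => ?_⟩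
    · rw [cfg_succ]
      simp only [rule, Rule.hotBody, Rule.select, Schema.holds_and, Schema.holds_var, hr, e0, e3,
        ed, h0, hlast, hd, not_false_eq_true, and_false, and_true, if_false, if_true, hx.colour j]
    · rw [cfg_succ]
      simp only [rule, Rule.hotBody, Rule.select, Schema.holds_and, Schema.holds_var, hr, e0,
        ed, h0, hd, not_false_eq_true, and_false, and_true, if_false, if_true, hy.parent j]
    · rw [cfg_succ]
      simp only [rule, Rule.hotBody, Rule.select, Schema.holds_var, e0,
        ed, h0, hd, not_false_eq_true, if_false, if_true, hz.index j]

open Classical in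
variable (M) in
/-- The colour of the `i`th neighbour, or the complement of the own colour. -/
noncomputable def fetchColour (x : W → Fin Δ → ℕ) (w : W) (i : Fin Δ) : ℕ :=
  if h : ∃ v, M.IsNeighbour w i v then x h.choose i else 2 ^ (ℓ + 2) - (x w i + 1)

theorem fetchColour_of_isNeighbour (hM : M.IsGraphModel Δ) (x : W → Fin Δ → ℕ) {v w : W}
    {i : Fin Δ} (h : M.IsNeighbour w i v) : fetchColour M x w i = x v i := by
  have hex : ∃ v, M.IsNeighbour w i v := ⟨v, h⟩
  rw [fetchColour, dif_pos hex, hex.choose_spec.eq hM h]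

theorem fetchColour_lt {x : W → Fin Δ → ℕ} (hx : ∀ w i, x w i < 2 ^ (ℓ + 2)) (w : W) (i : Fin Δ) :
    fetchColour M x w i < 2 ^ (ℓ + 2) := by
  have := Nat.two_pow_pos (ℓ + 2)
  unfold fetchColour
  split_ifs
  · exact hx _ _
  · omega

theorem fetch_step (hM : M.IsGraphModel Δ) {t : ℕ} {x : W → Fin Δ → ℕ} (hN : 1 ≤ N)
    (ht : t < (ℓ + 4) * N) (h0 : t % (ℓ + 4) = 0) (hxlt : ∀ w i, x w i < 2 ^ (ℓ + 2))
    (hx : ∀ w i, Reads (N := N) M (colourS i) t w (x w i)) (w : W) (i : Fin Δ) :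
    Reads (N := N) M (colourS i) (t + 1) w (x w i) ∧
    Reads (N := N) M (parentS i) (t + 1) w (fetchColour M x w i) ∧
    Reads (N := N) M (indexS i) (t + 1) w 0 := by
  have hr := (cfg_reducing (Δ := Δ) M hN t w).2 ht
  have e0 := holds_ringS (Δ := Δ) (N := N) M t w (show 0 < ℓ + 4 by omega)
  refine ⟨reads_colourS M (hxlt w i) fun j => ?_,
    reads_parentS M (fetchColour_lt hxlt w i) fun j => ?_,
      reads_indexS M (by positivity) fun j => ?_⟩
  · rw [cfg_succ]
    simp only [rule, Rule.hotBody, Rule.select, Schema.holds_and, Schema.holds_var, hr, e0, h0,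
      and_true, if_true, (hx w i).colour j]
  · rw [cfg_succ]
    simp only [rule, Rule.hotBody, Rule.select, Schema.holds_and, Schema.holds_var, hr, e0, h0,
      and_true, if_true, fetchS, Schema.holds_or, Schema.holds_dia, Schema.holds_neg,
      Schema.holds_top, hx _ i _]
    by_cases hex : ∃ v, M.IsNeighbour w i v
    · obtain ⟨v, hv⟩ := hex
      rw [fetchColour_of_isNeighbour hM x hv, KripkeModel.exists_isNeighbour_and_iff hM hv
        (fun v => (x v i).testBit j = true)]
      have : ∃ v, M.IsNeighbour w i v := ⟨v, hv⟩
      simp [this]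
    · rw [fetchColour, dif_neg hex, Nat.testBit_two_pow_sub_succ (hxlt w i)]
      simp only [not_exists] at hex
      simp [hex]
  · rw [cfg_succ]
    simp only [rule, Rule.hotBody, Rule.select, e0, h0, if_true, Schema.holds_bot,
      Nat.zero_testBit, Bool.false_eq_true]

/-- For a node without target the complement is a valid partner: the two numbers add up to 2^(ℓ + 2)
− 1, which is odd. -/
theorem fetchColour_ne (hM : M.IsGraphModel Δ) {x : W → Fin Δ → ℕ}
    (hxlt : ∀ w i, x w i < 2 ^ (ℓ + 2))
    (hprop : ∀ v w (i : Fin Δ), M.IsNeighbour w i v → x w i ≠ x v i) (w : W) (i : Fin Δ) :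
    x w i ≠ fetchColour M x w i := by
  by_cases hex : ∃ v, M.IsNeighbour w i v
  · obtain ⟨v, hv⟩ := hex
    rw [fetchColour_of_isNeighbour hM x hv]
    exact hprop v w i hv
  · rw [fetchColour, dif_neg hex]
    have := hxlt w i
    have : 2 ^ (ℓ + 2) = 2 * 2 ^ (ℓ + 1) := by rw [pow_succ]; ring
    omega

theorem scan_steps {t : ℕ} {w : W} {i : Fin Δ} {x y : ℕ} (hN : 1 ≤ N)
    (ht : t + (ℓ + 4) ≤ (ℓ + 4) * N) (h0 : t % (ℓ + 4) = 0)
    (hxlt : x < 2 ^ (ℓ + 2)) (hylt : y < 2 ^ (ℓ + 2)) (hxy : x ≠ y)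
    (hx : Reads (N := N) M (colourS i) (t + 1) w x)
    (hy : Reads (N := N) M (parentS i) (t + 1) w y)
    (hz : Reads (N := N) M (indexS i) (t + 1) w 0) {s : ℕ} (hs : s ≤ ℓ + 2) :
    Reads (N := N) M (colourS i) (t + 1 + s) w (scanStep^[s] (x, y, 0)).1 ∧
    Reads (N := N) M (parentS i) (t + 1 + s) w (scanStep^[s] (x, y, 0)).2.1 ∧
    Reads (N := N) M (indexS i) (t + 1 + s) w (scanStep^[s] (x, y, 0)).2.2 := by
  induction s with
  | zero => exact ⟨hx, hy, hz⟩
  | succ s ih =>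
    obtain ⟨i1, i2, i3⟩ := ih (by omega)
    have hmod : (t + 1 + s) % (ℓ + 4) = 1 + s := by
      rw [add_assoc, Nat.add_mod, h0, zero_add, Nat.mod_mod, Nat.mod_eq_of_lt (by omega)]
    obtain ⟨k, -, he, -, -⟩ := iterate_scanStep x y s
    have hlt := (scanStep_iterate_lt (s := s + 1) hxlt hylt hxy).trans (lt_two_pow_bitLog (ℓ + 2))
    rw [Function.iterate_succ_apply'] at hlt ⊢
    refine scan_step hN (t := t + 1 + s) (by omega) (by omega) (by omega) ?_ ?_ hlt i1 i2 i3
    · rw [he]; exact (Nat.div_le_self _ _).trans_lt hxlt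
    · rw [he]; exact (Nat.div_le_self _ _).trans_lt hylt

/-- The current width m enters only the analysis; the program scans all ℓ + 2 positions in every
phase. -/
theorem reduction_phase (hM : M.IsGraphModel Δ) {t m : ℕ} {x : W → Fin Δ → ℕ} (hN : 1 ≤ N)
    (hℓ : 1 ≤ ℓ) (hm1 : 1 ≤ m) (ht : t + (ℓ + 4) ≤ (ℓ + 4) * N) (h0 : t % (ℓ + 4) = 0) (hm : m ≤ ℓ + 2)
    (hxlt : ∀ w i, x w i < 2 ^ m)
    (hprop : ∀ v w (i : Fin Δ), M.IsNeighbour w i v → x w i ≠ x v i)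
    (hx : ∀ w i, Reads (N := N) M (colourS i) t w (x w i)) :
    ∃ x' : W → Fin Δ → ℕ, (∀ w i, x' w i < 2 * m) ∧
      (∀ v w (i : Fin Δ), M.IsNeighbour w i v → x' w i ≠ x' v i) ∧
      ∀ w i, Reads (N := N) M (colourS i) (t + (ℓ + 4)) w (x' w i) := by
  have hle : 2 ^ m ≤ 2 ^ (ℓ + 2) := Nat.pow_le_pow_right (by norm_num) hm
  have hxlt' : ∀ w i, x w i < 2 ^ (ℓ + 2) := fun w i => (hxlt w i).trans_le hle
  have hylt := fetchColour_lt (M := M) hxlt'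
  have hxy := fetchColour_ne hM hxlt' hprop
  refine ⟨fun w i => reduceColour (ℓ + 2) (x w i) (fetchColour M x w i), fun w i => ?_,
    fun v w i hv => ?_, fun w i => ?_⟩
  · by_cases hex : ∃ v, M.IsNeighbour w i v
    · obtain ⟨v, hv⟩ := hex
      refine reduceColour_lt (hxlt w i) ?_ hm (hxy w i)
      rw [fetchColour_of_isNeighbour hM x hv]
      exact hxlt v i
    -- The complement is taken in the full register and may need more than m bits, so the general
    -- bound does not apply. But the search stops at bit 0, and the new colour is just the own
    -- lowest bit.
    · have hpar : x w i % 2 ≠ fetchColour M x w i % 2 := by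
        rw [fetchColour, dif_neg hex]
        have := hxlt' w i
        have : 2 ^ (ℓ + 2) = 2 * 2 ^ (ℓ + 1) := by rw [pow_succ]; ring
        omega
      have hfix : scanStep (x w i, fetchColour M x w i, 0) = (x w i, fetchColour M x w i, 0) := by
        simp [scanStep, hpar]
      have : reduceColour (ℓ + 2) (x w i) (fetchColour M x w i) = x w i % 2 := by
        rw [reduceColour, Function.iterate_fixed hfix]; simp
      dsimp only
      omega
  · have : fetchColour M x w i = x v i := fetchColour_of_isNeighbour hM x hv
    dsimp only
    rw [this]
    exact reduceColour_ne (hxlt' w i) (hxlt' v i) (hylt v i) le_rfl (hprop v w i hv) (hxy v i)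
  · have htlt : t < (ℓ + 4) * N := by omega
    obtain ⟨f1, f2, f3⟩ := fetch_step hM hN htlt h0 hxlt' hx w i
    obtain ⟨s1, s2, s3⟩ := scan_steps hN ht h0 (hxlt' w i) (hylt w i) (hxy w i) f1 f2 f3 le_rfl
    have hlt := reduceColour_lt (hxlt' w i) (hylt w i) le_rfl (hxy w i)
    have hmod : (t + 1 + (ℓ + 2)) % (ℓ + 4) = ℓ + 3 := by
      rw [add_assoc, Nat.add_mod, h0, zero_add, Nat.mod_mod, Nat.mod_eq_of_lt (by omega)]
      omega
    have hr := (cfg_reducing (Δ := Δ) M hN (t + 1 + (ℓ + 2)) w).2 (by omega)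
    have e0 := holds_ringS (Δ := Δ) (N := N) M (t + 1 + (ℓ + 2)) w (show 0 < ℓ + 4 by omega)
    have e3 := holds_ringS (Δ := Δ) (N := N) M (t + 1 + (ℓ + 2)) w (show ℓ + 3 < ℓ + 4 by omega)
    refine reads_colourS M (hlt.trans_le (two_mul_le_two_pow (by omega))) fun j => ?_
    rw [show t + (ℓ + 4) = t + 1 + (ℓ + 2) + 1 by ring, cfg_succ]
    simp only [rule, Rule.hotBody, Rule.select, Schema.holds_and, Schema.holds_var, hr, e0, e3,
      hmod, show ¬ ℓ + 3 = 0 by omega, and_false, and_true, if_false, if_true]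
    rcases hj : (j : ℕ) with _ | k
    -- After the scan the lowest bit of the shifted register is the own bit at the differing
    -- position, so bit 0 stays and the counter fills the higher bits.
    · rw [if_pos rfl, s1 0, reduceColour, Nat.testBit_zero, Nat.testBit_zero]
      have : ∀ a b : ℕ, (2 * a + b % 2) % 2 = b % 2 := fun a b => by omega
      rw [this]
    · rw [if_neg (by omega), Nat.add_sub_cancel, s3 k, reduceColour, Nat.testBit_succ]
      have : ∀ a b : ℕ, (2 * a + b % 2) / 2 = a := fun a b => by omega
      rw [this]

theorem reduction_phases (hM : M.IsGraphModel Δ) (hN : 1 ≤ N) (hℓ : 1 ≤ ℓ) {p : ℕ} (hp : p ≤ N) :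
    ∃ x : W → Fin Δ → ℕ, (∀ w i, x w i < 2 ^ reducedWidth^[p] ℓ) ∧
      (∀ v w (i : Fin Δ), M.IsNeighbour w i v → x w i ≠ x v i) ∧
      ∀ w i, Reads (N := N) M (colourS i) ((ℓ + 4) * p) w (x w i) := by
  induction p with
  | zero =>
    refine ⟨fun w _ => M.ident w, fun w _ => M.ident_lt w, fun v w i hv h => ?_, fun w i => ?_⟩
    -- The initial colours are the identifiers, so a conflict would be a loop.
    · exact hM.irrefl v (by simpa [hM.ident_injective h] using hv.1)
    · refine reads_colourS M ((M.ident_lt w).trans_le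
        (Nat.pow_le_pow_right (by norm_num) (by omega))) fun j => ?_
      rw [mul_zero, cfg_zero, M.testBit_ident, terminal]
      split_ifs with h
      · simp [h]
      · simp [h]
  | succ p ih =>
    obtain ⟨x, h1, h2, h3⟩ := ih (by omega)
    have hpos : ∀ p, 1 ≤ reducedWidth^[p] ℓ := by
      intro p
      induction p with
      | zero => simpa using hℓ
      | succ p ih =>
        rw [Function.iterate_succ_apply']
        exact Nat.clog_pos (by norm_num) (by omega)
    obtain ⟨x', h1', h2', h3'⟩ := reduction_phase hM hN hℓ (hpos p)
      (by nlinarith [Nat.mul_le_mul_left (ℓ + 4) hp]) (by simp)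
      (iterate_reducedWidth_le (by omega) (by omega) p) h1 h2 h3
    refine ⟨x', fun w i => ?_, h2', h3'⟩
    rw [Function.iterate_succ_apply']
    exact (h1' w i).trans_le (two_mul_le_two_pow_reducedWidth _)

/-- At the end of the reduction phases there are at most six colours. -/
theorem reduction_end (hM : M.IsGraphModel Δ) (hN : 1 ≤ N) (hℓ : 1 ≤ ℓ)
    (hw : reducedWidth^[N - 1] ℓ ≤ 3) :
    ∃ x : W → Fin Δ → ℕ, (∀ w i, x w i < 6) ∧
      (∀ v w (i : Fin Δ), M.IsNeighbour w i v → x w i ≠ x v i) ∧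
      ∀ w i, Reads (N := N) M (colourS i) ((ℓ + 4) * N) w (x w i) := by
  obtain ⟨p, rfl⟩ := Nat.exists_eq_add_of_le' hN
  obtain ⟨x, h1, h2, h3⟩ := reduction_phases (p := p) hM hN hℓ (by omega)
  -- The last phase uses the bound 2 · 3 = 6 on the colours themselves; rounding up to a width would
  -- give only 8.
  exact reduction_phase (m := 3) hM hN hℓ (by norm_num) (le_of_eq (mul_add_one _ _).symm) (by simp)
    (by omega) (fun w i => (h1 w i).trans_le (Nat.pow_le_pow_right (by norm_num) hw)) h2 h3

end Colouring
end MPMSC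

namespace MPMSC

theorem ofBits_testBit {x : ℕ} (hx : x < 8) :
    ofBits (x.testBit 0) (x.testBit 1) (x.testBit 2) = x := by
  interval_cases x <;> rfl

theorem thirdColour_spec (x y : ℕ) :
    thirdColour x y < 3 ∧ thirdColour x y ≠ x ∧ thirdColour x y ≠ y := by
  unfold thirdColour; split_ifs <;> omega

namespace Colouring

variable {ℓ Δ N : ℕ} {W : Type u} {M : KripkeModel ℓ W}

/-! ### Three colours -/

open Classical in
variable (M) in
/-- The colour of the `i`th neighbour, or `0`. -/
noncomputable def succColour (x : W → Fin Δ → ℕ) (w : W) (i : Fin Δ) : ℕ :=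
  if h : ∃ v, M.IsNeighbour w i v then x h.choose i else 0

theorem succColour_of_isNeighbour (hM : M.IsGraphModel Δ) (x : W → Fin Δ → ℕ) {v w : W}
    {i : Fin Δ} (h : M.IsNeighbour w i v) : succColour M x w i = x v i := by
  have hex : ∃ v, M.IsNeighbour w i v := ⟨v, h⟩
  rw [succColour, dif_pos hex, hex.choose_spec.eq hM h]

theorem succColour_of_not_exists (x : W → Fin Δ → ℕ) {w : W} {i : Fin Δ}
    (h : ¬ ∃ v, M.IsNeighbour w i v) : succColour M x w i = 0 := dif_neg h

/-- The default 0 in `succColour` matches the falsity of every diamond at a node without target. -/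
theorem holds_dia_reads (hM : M.IsGraphModel Δ) {t : ℕ} {x : W → Fin Δ → ℕ} {i : Fin Δ}
    {S : ℕ → Schema ℓ Δ (Head ℓ Δ N)} (hx : ∀ w, Reads M S t w (x w i)) (w : W) (j : ℕ) :
    (Schema.dia i (S j)).Holds M (cfg Δ N M t) w ↔ (succColour M x w i).testBit j = true := by
  rw [Schema.holds_dia]
  by_cases hex : ∃ v, M.IsNeighbour w i v
  · obtain ⟨v, hv⟩ := hex
    rw [KripkeModel.exists_isNeighbour_and_iff hM hv, succColour_of_isNeighbour hM x hv]
    exact hx v j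
  · rw [succColour_of_not_exists x hex]
    simp only [not_exists] at hex
    simp [hex]

theorem succColour_lt {x : W → Fin Δ → ℕ} {b : ℕ} (hb : 0 < b) (hx : ∀ w i, x w i < b) (w : W)
    (i : Fin Δ) : succColour M x w i < b := by
  unfold succColour
  split_ifs
  · exact hx _ _
  · exact hb

open Classical in
theorem holds_shiftS (hM : M.IsGraphModel Δ) {t : ℕ} {x : W → Fin Δ → ℕ}
    (hxlt : ∀ w i, x w i < 8) (hx : ∀ w i, Reads (N := N) M (colourS i) t w (x w i)) (w : W)
    (i : Fin Δ) (j : ℕ) :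
    (shiftS i j : Schema ℓ Δ (Head ℓ Δ N)).Holds M (cfg Δ N M t) w ↔
      (shiftColour (x w i) (succColour M x w i)
        (decide (∃ v, M.IsNeighbour w i v))).testBit j = true := by
  have hd := holds_dia_reads hM (fun w => hx w i) w
  rw [shiftS, Schema.holds_table]
  simp only [List.map_cons, List.map_nil, hd, hx w i _, Schema.holds_dia, Schema.holds_top,
    and_true, Bool.decide_eq_true, shiftBit, ofBits_testBit (hxlt w i),
    ofBits_testBit (succColour_lt (M := M) (by norm_num) hxlt w i)]

theorem holds_removeS (hM : M.IsGraphModel Δ) {t : ℕ} {x y : W → Fin Δ → ℕ}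
    (hxlt : ∀ w i, x w i < 8) (hylt : ∀ w i, y w i < 8)
    (hx : ∀ w i, Reads (N := N) M (colourS i) t w (x w i))
    (hy : ∀ w i, Reads (N := N) M (parentS i) t w (y w i)) (e : ℕ) (w : W)
    (i : Fin Δ) (j : ℕ) :
    (removeS e i j : Schema ℓ Δ (Head ℓ Δ N)).Holds M (cfg Δ N M t) w ↔
      (removeColour e (x w i) (y w i) (succColour M y w i)).testBit j = true := by
  have hd := holds_dia_reads hM (fun w => hy w i) w
  rw [removeS, Schema.holds_table]
  simp only [List.map_cons, List.map_nil, hd, hx w i _, hy w i _,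
    Bool.decide_eq_true, removeBit, ofBits_testBit (hxlt w i), ofBits_testBit (hylt w i),
    ofBits_testBit (succColour_lt (M := M) (by norm_num) hylt w i)]

/-- After the reduction phases the colours change only in three steps. -/
theorem colour_hold (hN : 1 ≤ N) {t : ℕ} {w : W} {i : Fin Δ} {x : ℕ} (ht : (ℓ + 4) * N ≤ t)
    (h1 : t ≠ (ℓ + 4) * N + 1) (h3 : t ≠ (ℓ + 4) * N + 3) (h5 : t ≠ (ℓ + 4) * N + 5)
    (hxlt : x < 2 ^ (ℓ + 2)) (hx : Reads (N := N) M (colourS i) t w x) :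
    Reads (N := N) M (colourS i) (t + 1) w x := by
  have hr := cfg_reducing (Δ := Δ) M hN t w
  have hpos : 0 < 3 ^ Δ := by positivity
  refine reads_colourS M hxlt fun j => ?_
  rw [cfg_succ]
  simp only [rule, Rule.hotBody, Rule.select, Schema.holds_and, Schema.holds_var, hr,
    not_lt.2 ht, false_and, if_false, holds_stepS M hN t w (show 1 < 3 ^ Δ + 7 by omega),
    holds_stepS M hN t w (show 3 < 3 ^ Δ + 7 by omega),
    holds_stepS M hN t w (show 5 < 3 ^ Δ + 7 by omega), h1, h3, h5, hx.colour j]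

/-- After a shift, all nodes pointing to a node share its old colour. So a node with the colour 5 −
r has only two colours to avoid, its own old one and the shifted one of its target, and one of 0, 1,
2 is free. -/
theorem removal_step (hM : M.IsGraphModel Δ) (hN : 1 ≤ N) (hℓ : 1 ≤ ℓ) {r : ℕ} (hr : r < 3)
    {x : W → Fin Δ → ℕ} (hxlt : ∀ w i, x w i < 6 - r)
    (hprop : ∀ v w (i : Fin Δ), M.IsNeighbour w i v → x w i ≠ x v i)
    (hx : ∀ w i, Reads (N := N) M (colourS i) ((ℓ + 4) * N + 2 * r) w (x w i)) :
    ∃ x' : W → Fin Δ → ℕ, (∀ w i, x' w i < 5 - r) ∧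
      (∀ v w (i : Fin Δ), M.IsNeighbour w i v → x' w i ≠ x' v i) ∧
      ∀ w i, Reads (N := N) M (colourS i) ((ℓ + 4) * N + 2 * (r + 1)) w (x' w i) := by
  classical
  have h8 : 8 ≤ 2 ^ (ℓ + 2) :=
    (show 8 = 2 ^ 3 by norm_num) ▸ Nat.pow_le_pow_right (by norm_num) (by omega)
  have hpos : 0 < 3 ^ Δ := by positivity
  set T := (ℓ + 4) * N with hT
  set y : W → Fin Δ → ℕ := fun w i =>
    shiftColour (x w i) (succColour M x w i) (decide (∃ v, M.IsNeighbour w i v)) with hy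
  have hylt : ∀ w i, y w i < 6 - r := by
    intro w i
    have := succColour_lt (M := M) (show 0 < 6 - r by omega) hxlt w i
    simp only [hy, shiftColour]
    split_ifs <;> omega
  have hysucc : ∀ v w (i : Fin Δ), M.IsNeighbour w i v → y w i = x v i := by
    intro v w i hv
    have hex : ∃ v, M.IsNeighbour w i v := ⟨v, hv⟩
    simp only [hy, shiftColour, hex, decide_true, if_true]
    exact succColour_of_isNeighbour hM x hv
  have hyx : ∀ w i, y w i ≠ x w i := by
    intro w i
    by_cases hex : ∃ v, M.IsNeighbour w i v
    · obtain ⟨v, hv⟩ := hex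
      rw [hysucc v w i hv]
      exact (hprop v w i hv).symm
    · simp only [hy, shiftColour, hex, decide_false, Bool.false_eq_true, if_false]
      split_ifs <;> omega
  have hx1 : ∀ w i, Reads (N := N) M (colourS i) (T + 2 * r + 1) w (x w i) := fun w i =>
    colour_hold hN (by omega) (by omega) (by omega) (by omega)
      (by have := hxlt w i; omega) (hx w i)
  have hy1 : ∀ w i, Reads (N := N) M (parentS i) (T + 2 * r + 1) w (y w i) := by
    intro w i
    refine reads_parentS M (by have := hylt w i; omega) fun j => ?_
    have hred := cfg_reducing (Δ := Δ) M hN (T + 2 * r) w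
    have hcond : T + 2 * r = T + 0 ∨ T + 2 * r = T + 2 ∨ T + 2 * r = T + 4 := by omega
    rw [cfg_succ]
    simp only [rule, Rule.hotBody, Rule.select, Schema.holds_and, Schema.holds_or,
      Schema.holds_var, hred, ← hT, show ¬ T + 2 * r < T by omega, false_and, if_false,
      holds_stepS M hN (T + 2 * r) w (show 0 < 3 ^ Δ + 7 by omega),
      holds_stepS M hN (T + 2 * r) w (show 2 < 3 ^ Δ + 7 by omega),
      holds_stepS M hN (T + 2 * r) w (show 4 < 3 ^ Δ + 7 by omega), if_pos hcond]
    exact holds_shiftS hM (fun w i => by have := hxlt w i; omega) hx w i j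
  refine ⟨fun w i => removeColour (5 - r) (x w i) (y w i) (succColour M y w i), fun w i => ?_,
    fun v w i hv => ?_, fun w i => ?_⟩
  · have h1 := (thirdColour_spec (x w i) (succColour M y w i)).1
    have h2 := hylt w i
    simp only [removeColour]
    split_ifs <;> omega
  -- Both ends cannot be recoloured, since the shifted colours differ along the edge. If only `w`
  -- is, it avoids the shifted colour of `v`; if only `v` is, it avoids its old colour, which is the
  -- shifted colour of `w`.
  · have h1 := thirdColour_spec (x w i) (succColour M y w i)
    have h2 := thirdColour_spec (x v i) (succColour M y v i)
    rw [succColour_of_isNeighbour hM y hv] at h1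
    have h3 := hysucc v w i hv
    have h4 := hyx v i
    simp only [removeColour, succColour_of_isNeighbour hM y hv]
    split_ifs <;> omega
  · have hrem := holds_removeS hM (t := T + 2 * r + 1)
      (fun w i => by have := hxlt w i; omega) (fun w i => by have := hylt w i; omega)
      hx1 hy1 (5 - r) w i
    have hlt : removeColour (5 - r) (x w i) (y w i) (succColour M y w i) < 8 := by
      have h1 := (thirdColour_spec (x w i) (succColour M y w i)).1
      have h2 := hylt w i
      simp only [removeColour]
      split_ifs <;> omega
    refine reads_colourS M (hlt.trans_le h8) fun j => ?_
    rw [← hrem j]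
    have hred := cfg_reducing (Δ := Δ) M hN (T + 2 * r + 1) w
    rw [show T + 2 * (r + 1) = T + 2 * r + 1 + 1 by ring, cfg_succ]
    simp only [rule, Rule.hotBody, Rule.select, Schema.holds_and,
      Schema.holds_var, hred, ← hT, show ¬ T + 2 * r + 1 < T by omega, false_and, if_false,
      holds_stepS M hN (T + 2 * r + 1) w (show 1 < 3 ^ Δ + 7 by omega),
      holds_stepS M hN (T + 2 * r + 1) w (show 3 < 3 ^ Δ + 7 by omega),
      holds_stepS M hN (T + 2 * r + 1) w (show 5 < 3 ^ Δ + 7 by omega)]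
    interval_cases r
    · simp
    · simp
    · simp

/-- After the removal steps there are at most three colours, and they do not change any more. -/
theorem removal_end (hM : M.IsGraphModel Δ) (hN : 1 ≤ N) (hℓ : 1 ≤ ℓ)
    (hw : reducedWidth^[N - 1] ℓ ≤ 3) :
    ∃ x : W → Fin Δ → ℕ, (∀ w i, x w i < 3) ∧
      (∀ v w (i : Fin Δ), M.IsNeighbour w i v → x w i ≠ x v i) ∧
      ∀ s w i, Reads (N := N) M (colourS i) ((ℓ + 4) * N + 6 + s) w (x w i) := by
  obtain ⟨x₀, a₀, b₀, c₀⟩ := reduction_end (N := N) hM hN hℓ hw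
  obtain ⟨x₁, a₁, b₁, c₁⟩ := removal_step hM hN hℓ (r := 0) (by norm_num) a₀ b₀ c₀
  obtain ⟨x₂, a₂, b₂, c₂⟩ := removal_step hM hN hℓ (r := 1) (by norm_num) a₁ b₁ c₁
  obtain ⟨x₃, a₃, b₃, c₃⟩ := removal_step hM hN hℓ (r := 2) (by norm_num) a₂ b₂ c₂
  have h4 : 2 ^ 2 ≤ 2 ^ (ℓ + 2) := Nat.pow_le_pow_right (by norm_num) (by omega)
  refine ⟨x₃, a₃, b₃, fun s w i => ?_⟩
  induction s with
  | zero => exact c₃ w i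
  | succ s ih =>
    exact colour_hold hN (t := (ℓ + 4) * N + 6 + s) (by omega) (by omega) (by omega) (by omega)
      (by have := a₃ w i; omega) ih

/-! ### One-hot codes -/

/-- The number with the ternary digits `x 0, …, x (k - 1)`. -/
def codeValue (x : ℕ → ℕ) : ℕ → ℕ
  | 0 => 0
  | k + 1 => 3 * codeValue x k + x k

theorem codeValue_lt {x : ℕ → ℕ} (hx : ∀ k, x k < 3) (k : ℕ) : codeValue x k < 3 ^ k := by
  induction k with
  | zero => simp [codeValue]
  | succ k ih => have := hx k; rw [codeValue, pow_succ]; omega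

theorem eq_of_codeValue_eq {x y : ℕ → ℕ} (hx : ∀ k, x k < 3) (hy : ∀ k, y k < 3) {k : ℕ}
    (h : codeValue x k = codeValue y k) : ∀ i < k, x i = y i := by
  induction k with
  | zero => intro i hi; omega
  | succ k ih =>
    have h1 := hx k
    have h2 := hy k
    rw [codeValue, codeValue] at h
    intro i hi
    rcases Nat.lt_succ_iff_lt_or_eq.1 hi with hi | rfl
    · exact ih (by omega) i hi
    · omega

/-- The digits of a node. -/
def digits (x : W → Fin Δ → ℕ) (w : W) (k : ℕ) : ℕ := if h : k < Δ then x w ⟨k, h⟩ else 0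

theorem digits_lt {x : W → Fin Δ → ℕ} (hx : ∀ w i, x w i < 3) (w : W) (k : ℕ) :
    digits x w k < 3 := by
  unfold digits; split_ifs
  · exact hx _ _
  · norm_num

theorem holds_digitS {x : W → Fin Δ → ℕ} {t : ℕ} (hxlt : ∀ w i, x w i < 3)
    (hx : ∀ w i, Reads (N := N) M (colourS i) t w (x w i)) (w : W) {k d : ℕ} (hk : k < Δ)
    (hd : d < 3) :
    (digitS k d : Schema ℓ Δ (Head ℓ Δ N)).Holds M (cfg Δ N M t) w ↔ d = digits x w k := by
  have hlt := hxlt w ⟨k, hk⟩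
  have h0 := hx w ⟨k, hk⟩ 0
  have h1 := hx w ⟨k, hk⟩ 1
  simp only [digitS, hk, dif_pos, Schema.holds_and, bitS, digits]
  generalize x w ⟨k, hk⟩ = e at *
  interval_cases d <;> interval_cases e <;> simp [Nat.testBit_eq_decide_div_mod_eq] at h0 h1 ⊢ <;>
    simp [h0, h1]

/-- Once the digits are stable, correctness spreads by one prefix length per round. The code of
length 0 needs `0 < t₀`, because it is false in round 0. -/
theorem cfg_code {x : W → Fin Δ → ℕ} {t₀ : ℕ} (ht₀ : 0 < t₀) (hxlt : ∀ w i, x w i < 3)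
    (hx : ∀ s w i, Reads (N := N) M (colourS i) (t₀ + s) w (x w i)) (w : W) {k : ℕ}
    (hk : k < Δ + 1) {s : ℕ} (hs : k ≤ s) (c : Fin (3 ^ k)) :
    cfg Δ N M (t₀ + s) w (.code ⟨k, hk⟩ c) ↔ (c : ℕ) = codeValue (digits x w) k := by
  induction k generalizing s with
  | zero =>
    obtain ⟨t, ht⟩ := Nat.exists_eq_add_of_le' (show 1 ≤ t₀ + s by omega)
    have hc : (c : ℕ) < 1 := c.isLt.trans_eq (pow_zero 3)
    rw [ht, cfg_succ]
    simp only [rule, Rule.hotBody, Rule.select, if_true, Schema.holds_top, codeValue, true_iff]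
    omega
  | succ k ih =>
    obtain ⟨s, rfl⟩ := Nat.exists_eq_add_of_le' (show 1 ≤ s by omega)
    have hc : (c : ℕ) < 3 ^ k * 3 := c.isLt.trans_eq (pow_succ 3 k)
    have hc3 : (c : ℕ) / 3 < 3 ^ k := by omega
    rw [← add_assoc, cfg_succ]
    simp only [rule, Rule.hotBody, Rule.select, Nat.add_eq_zero_iff, one_ne_zero, and_false,
      if_false, Nat.add_sub_cancel, Schema.holds_and, codeS, show k < Δ + 1 by omega, dif_pos, hc3,
      Schema.holds_var,
      holds_digitS hxlt (hx s) w (show k < Δ by omega) (Nat.mod_lt (c : ℕ) (by norm_num)),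
      codeValue]
    refine (and_congr_left' (ih (show k < Δ + 1 by omega) (show k ≤ s by omega) ⟨_, hc3⟩)).trans ?_
    have := digits_lt hxlt w k
    dsimp only
    omega

/-- A proper numbering of the nodes by numbers below `3 ^ Δ`, in one-hot code. -/
theorem code_end (hM : M.IsGraphModel Δ) (hN : 1 ≤ N) (hℓ : 1 ≤ ℓ)
    (hw : reducedWidth^[N - 1] ℓ ≤ 3) :
    ∃ D : W → ℕ, (∀ w, D w < 3 ^ Δ) ∧ (∀ v w, M.R w v → D w ≠ D v) ∧
      ∀ s, Δ ≤ s → ∀ w c, (codeS Δ c : Schema ℓ Δ (Head ℓ Δ N)).Holds M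
        (cfg Δ N M ((ℓ + 4) * N + 6 + s)) w ↔ c = D w := by
  obtain ⟨x, h1, h2, h3⟩ := removal_end (N := N) hM hN hℓ hw
  refine ⟨fun w => codeValue (digits x w) Δ, fun w => codeValue_lt (digits_lt h1 w) Δ,
    fun v w hR h => ?_, fun s hs w c => ?_⟩
  · obtain ⟨i, hi⟩ := KripkeModel.exists_isNeighbour hM hR
    have := eq_of_codeValue_eq (digits_lt h1 w) (digits_lt h1 v) h i i.isLt
    simp only [digits, i.isLt, dif_pos] at this
    exact h2 v w i hi this
  · have hlt := codeValue_lt (digits_lt h1 w) Δ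
    simp only [codeS, Nat.lt_succ_self, dif_pos]
    split_ifs with hc
    · exact cfg_code (by omega) h1 h3 w (Nat.lt_succ_self Δ) hs ⟨c, hc⟩
    · simp only [Schema.holds_bot, false_iff]
      omega

end Colouring
end MPMSC

namespace MPMSC
namespace Colouring

variable {ℓ Δ N : ℕ} {W : Type u} {M : KripkeModel ℓ W}

/-! ### Greedy colouring -/

theorem holds_freeS (hM : M.IsGraphModel Δ) {t : ℕ} {f : W → Option (Fin (Δ + 1))}
    (hf : ∀ w a, cfg Δ N M t w (.palette a) ↔ f w = some a) (w : W) (a : Fin (Δ + 1)) :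
    (freeS a : Schema ℓ Δ (Head ℓ Δ N)).Holds M (cfg Δ N M t) w ↔
      ∀ v, M.R w v → f v ≠ some a := by
  simp only [freeS, Schema.holds_conj, List.mem_map, List.mem_finRange, true_and,
    forall_exists_index, forall_apply_eq_imp_iff, Schema.holds_neg, Schema.holds_dia,
    Schema.holds_var, hf, not_exists, not_and]
  constructor
  · intro h v hv
    obtain ⟨i, hi⟩ := KripkeModel.exists_isNeighbour hM hv
    exact h i v hi
  · intro h i v hi
    exact h v hi.1

theorem exists_holds_leastFreeS (hM : M.IsGraphModel Δ) {t : ℕ} {f : W → Option (Fin (Δ + 1))}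
    (hf : ∀ w a, cfg Δ N M t w (.palette a) ↔ f w = some a) (w : W) :
    ∃ b, (∀ v, M.R w v → f v ≠ some b) ∧ ∀ a,
      (leastFreeS a : Schema ℓ Δ (Head ℓ Δ N)).Holds M (cfg Δ N M t) w ↔ a = b := by
  classical
  have := hM.finite
  have hex : ∃ b : Fin (Δ + 1), ∀ v, M.R w v → f v ≠ some b := by
    by_contra hcon
    push Not at hcon
    choose g hg hg' using hcon
    -- Otherwise each of the Δ + 1 colours sits on a neighbour of its own, against the degree bound.
    have hinj : Function.Injective g := by
      intro a b hab
      have h1 := hg' a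
      rw [hab, hg' b] at h1
      exact (Option.some.inj h1).symm
    have h1 : (Set.range g).ncard ≤ {v | M.R w v}.ncard :=
      Set.ncard_le_ncard (by rintro _ ⟨a, rfl⟩; exact hg a) (Set.toFinite _)
    rw [← Set.image_univ, Set.ncard_image_of_injective _ hinj, Set.ncard_univ, Nat.card_fin] at h1
    have := hM.degree_le w
    omega
  obtain ⟨b, hb, hmin⟩ := WellFounded.has_min (wellFounded_lt (α := Fin (Δ + 1)))
    {b | ∀ v, M.R w v → f v ≠ some b} hex
  refine ⟨b, hb, fun a => ?_⟩
  simp only [leastFreeS, Schema.holds_and, Schema.holds_conj, List.mem_map, List.mem_filter,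
    List.mem_finRange, true_and, decide_eq_true_eq, forall_exists_index, and_imp,
    forall_apply_eq_imp_iff₂, Schema.holds_neg, holds_freeS hM hf]
  constructor
  · rintro ⟨h1, h2⟩
    have h3 : ¬ a < b := hmin a h1
    have h4 : ¬ b < a := fun h => h2 b h hb
    exact le_antisymm (not_lt.1 h4) (not_lt.1 h3)
  · rintro rfl
    exact ⟨hb, fun c hc hc' => hmin c hc' hc⟩

/-- Nodes with the same number are never adjacent, so a whole class can choose simultaneously
without conflict. -/
theorem greedy_end (hM : M.IsGraphModel Δ) (hN : 1 ≤ N) (hℓ : 1 ≤ ℓ) (hΔ : 1 ≤ Δ)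
    (hw : reducedWidth^[N - 1] ℓ ≤ 3) :
    ∃ f : W → Fin (Δ + 1), (∀ v w, M.R v w → f v ≠ f w) ∧
      ∀ w a, cfg Δ N M ((ℓ + 4) * N + (3 ^ Δ + 6)) w (.palette a) ↔ f w = a := by
  classical
  obtain ⟨D, hDlt, hDprop, hD⟩ := code_end (N := N) hM hN hℓ hw
  set T := (ℓ + 4) * N with hT
  have hpow := succ_lt_three_pow hΔ
  -- Invariant: a proper partial colouring that covers all classes below Δ + 1 + r. It starts with
  -- the classes that are themselves palette colours.
  have hinv : ∀ r, Δ + 1 + r ≤ 3 ^ Δ → ∃ f : W → Option (Fin (Δ + 1)),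
      (∀ w a, cfg Δ N M (T + 6 + (Δ + 1 + r)) w (.palette a) ↔ f w = some a) ∧
      (∀ v w, M.R v w → ∀ a, f v = some a → f w ≠ some a) ∧
      ∀ w, D w < Δ + 1 + r → f w ≠ none := by
    intro r hr
    induction r with
    | zero =>
      refine ⟨fun w => if h : D w < Δ + 1 then some ⟨D w, h⟩ else none, fun w a => ?_,
        fun v w hR a => ?_, fun w hlt => ?_⟩
      · rw [add_zero, ← add_assoc, cfg_succ]
        simp only [rule, Rule.hotBody, Rule.select,
          holds_stepS M hN (T + 6 + Δ) w (show 6 + Δ < 3 ^ Δ + 7 by omega),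
          if_pos (show T + 6 + Δ = (ℓ + 4) * N + (6 + Δ) by omega), hD Δ le_rfl]
        split_ifs with h
        · simp [Fin.ext_iff, eq_comm]
        · have := a.isLt
          simp only [iff_false]
          omega
      · have := hDprop w v hR
        dsimp only
        split_ifs
        · simp only [Option.some.injEq]
          rintro rfl h
          exact this (by simpa using h.symm)
        all_goals simp
      · dsimp only
        rw [dif_pos (by omega)]
        simp
    | succ r ih =>
      obtain ⟨f, hf, hprop, hcol⟩ := ih (by omega)
      choose b hb hb' using exists_holds_leastFreeS hM hf
      have hturn : ∀ w, cfg Δ N M (T + 6 + (Δ + 1 + r)) w .turn ↔ D w = Δ + 1 + r := by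
        intro w
        rw [show T + 6 + (Δ + 1 + r) = T + 6 + (Δ + r) + 1 by ring, cfg_succ]
        simp only [rule, Rule.hotBody, Rule.select, Schema.holds_disj, List.mem_map,
          List.mem_range, exists_exists_and_eq_and, Schema.holds_and,
          hD (Δ + r) (by omega)]
        constructor
        · rintro ⟨k, hk, h1, h2⟩
          rw [holds_stepS M hN _ w (by omega)] at h1
          omega
        · intro h
          refine ⟨r, by omega, ?_, h.symm⟩
          rw [holds_stepS M hN _ w (by omega)]
          omega
      refine ⟨fun w => if D w = Δ + 1 + r then some (b w) else f w, fun w a => ?_,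
        fun v w hR a => ?_, fun w hlt => ?_⟩
      · rw [← add_assoc (Δ + 1), ← add_assoc (T + 6), cfg_succ]
        have hg := (cfg_greedy (Δ := Δ) (N := N) M hN hΔ (T + 6 + (Δ + 1 + r)) w).2 (by omega)
        simp only [rule, Rule.hotBody, Rule.select, Schema.holds_var, hg, if_true,
          holds_stepS M hN (T + 6 + (Δ + 1 + r)) w (show 6 + Δ < 3 ^ Δ + 7 by omega),
          if_neg (show ¬ T + 6 + (Δ + 1 + r) = (ℓ + 4) * N + (6 + Δ) by omega),
          Schema.holds_ite, hturn, hb', hf]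
        split_ifs with h
        · simp [h, eq_comm]
        · simp [h]
      · have hne := hDprop w v hR
        have hR' := hM.symm v w hR
        dsimp only
        split_ifs with h1 h2 h2
        · omega
        · rintro h
          rw [← h]
          exact hb v w hR
        · intro h h'
          exact hb w v hR' (h.trans h'.symm)
        · exact hprop v w hR a
      · dsimp only
        split_ifs with h
        · simp
        · exact hcol w (by omega)
  -- Here 3^Δ = Δ + 1 + (r + 1), so the invariant at r + 1 covers every class.
  obtain ⟨r, hr⟩ := Nat.exists_eq_add_of_lt hpow
  obtain ⟨f, hf, hprop, hcol⟩ := hinv (r + 1) (by omega)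
  have hsome : ∀ w, ∃ a, f w = some a := fun w =>
    Option.ne_none_iff_exists'.1 (hcol w (by have := hDlt w; omega))
  choose g hg using hsome
  refine ⟨g, fun v w hR h => hprop v w hR (g v) (hg v) (h ▸ hg w), fun w a => ?_⟩
  rw [show T + (3 ^ Δ + 6) = T + 6 + (Δ + 1 + (r + 1)) by omega, hf, hg, Option.some.injEq]

/-! ### Communication rounds -/

variable (ℓ Δ N) in
/-- The communication rounds, shifted by one. -/
def commTimes : Finset ℕ :=
  (Finset.range N).image (fun p => (ℓ + 4) * p) ∪
    (Finset.Ico ((ℓ + 4) * N) ((ℓ + 4) * N + 6) ∪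
      Finset.Ico ((ℓ + 4) * N + (7 + Δ)) ((ℓ + 4) * N + (6 + 3 ^ Δ)))

theorem mem_commTimes {t : ℕ} : t ∈ commTimes ℓ Δ N ↔
    (t < (ℓ + 4) * N ∧ t % (ℓ + 4) = 0) ∨ ((ℓ + 4) * N ≤ t ∧ t < (ℓ + 4) * N + 6) ∨
      ((ℓ + 4) * N + (6 + Δ) < t ∧ t < (ℓ + 4) * N + (6 + 3 ^ Δ)) := by
  have h1 : t ∈ (Finset.range N).image (fun p => (ℓ + 4) * p) ↔
      t < (ℓ + 4) * N ∧ t % (ℓ + 4) = 0 := by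
    simp only [Finset.mem_image, Finset.mem_range]
    constructor
    · rintro ⟨p, hp, rfl⟩
      exact ⟨Nat.mul_lt_mul_of_pos_left hp (by omega), by simp⟩
    · rintro ⟨h1, h2⟩
      obtain ⟨p, rfl⟩ := Nat.dvd_of_mod_eq_zero h2
      exact ⟨p, Nat.lt_of_mul_lt_mul_left h1, rfl⟩
  simp only [commTimes, Finset.mem_union, h1, Finset.mem_Ico]
  omega

theorem card_commTimes (hΔ : 1 ≤ Δ) : (commTimes ℓ Δ N).card = N + 6 + (3 ^ Δ - Δ - 1) := by
  have hpow := succ_lt_three_pow hΔ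
  rw [commTimes, Finset.card_union_of_disjoint, Finset.card_union_of_disjoint,
    Finset.card_image_of_injective, Finset.card_range, Nat.card_Ico, Nat.card_Ico]
  · omega
  · intro a b h
    exact Nat.eq_of_mul_eq_mul_left (by omega) h
  · rw [Finset.disjoint_left]
    intro t h1 h2
    simp only [Finset.mem_Ico] at h1 h2
    omega
  · rw [Finset.disjoint_left]
    intro t h1 h2
    simp only [Finset.mem_image, Finset.mem_range, Finset.mem_union, Finset.mem_Ico] at h1 h2
    obtain ⟨p, hp, rfl⟩ := h1
    have := Nat.mul_lt_mul_of_pos_left hp (show 0 < ℓ + 4 by omega)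
    omega

theorem exists_md_pos_iff (hM : M.IsGraphModel Δ) (hN : 1 ≤ N) (hΔ : 1 ≤ Δ) (t : ℕ) :
    (∃ w, ∃ X : Head ℓ Δ N, 0 < ((rule X).hotBody M (cfg Δ N M t) w).md) ↔
      t ∈ commTimes ℓ Δ N := by
  have hpow := succ_lt_three_pow hΔ
  have e0 := fun w => holds_ringS (Δ := Δ) (N := N) M t w (show 0 < ℓ + 4 by omega)
  have hr := fun w => cfg_reducing (Δ := Δ) (N := N) M hN t w
  have hg := fun w => cfg_greedy (Δ := Δ) (N := N) M hN hΔ t w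
  have hs : ∀ k, k < 3 ^ Δ + 7 → ∀ w, (stepS k : Schema ℓ Δ (Head ℓ Δ N)).Holds M
      (cfg Δ N M t) w ↔ t = (ℓ + 4) * N + k := fun k hk w => holds_stepS M hN t w hk
  have hs0 := hs 0 (by omega)
  have hs1 := hs 1 (by omega)
  have hs2 := hs 2 (by omega)
  have hs3 := hs 3 (by omega)
  have hs4 := hs 4 (by omega)
  have hs5 := hs 5 (by omega)
  have hs6 := hs (6 + Δ) (by omega)
  rw [mem_commTimes]
  constructor
  · rintro ⟨w, X, hX⟩
    cases X with
    | ring q => simp only [rule, Rule.hotBody, Rule.select] at hX; split_ifs at hX <;> simp at hX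
    | phase p => simp only [rule, Rule.hotBody, Rule.select] at hX; split_ifs at hX <;> simp at hX
    | reducing => simp [rule, Rule.hotBody, Rule.select] at hX
    | step k => simp only [rule, Rule.hotBody, Rule.select] at hX; split_ifs at hX <;> simp at hX
    | greedy => simp [rule, Rule.hotBody, Rule.select] at hX
    | turn =>
      refine absurd hX (not_lt.2 ?_)
      exact Schema.md_disj_le (by simp)
    | colour i j =>
      simp only [rule, Rule.hotBody, Rule.select, Schema.holds_and, Schema.holds_var, hr, e0, hs1,
        hs3, hs5] at hX
      split_ifs at hX <;> simp at hX <;> omega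
    | parent i j =>
      simp only [rule, Rule.hotBody, Rule.select, Schema.holds_and, Schema.holds_or,
        Schema.holds_var, hr, e0, hs0, hs2, hs4] at hX
      split_ifs at hX <;> simp at hX <;> omega
    | index i j =>
      refine absurd hX (not_lt.2 ?_)
      simp only [rule, Rule.hotBody, Rule.select]
      split_ifs
      · simp
      · simp
      · simp only [Schema.md_xor, Schema.md_var]
        exact max_le le_rfl (Schema.md_conj_le (by simp))
    | code k c => simp only [rule, Rule.hotBody, Rule.select] at hX; split_ifs at hX <;> simp at hX
    | palette a =>
      simp only [rule, Rule.hotBody, Rule.select, Schema.holds_var, hg, hs6] at hX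
      split_ifs at hX <;> simp at hX
      omega
  · intro h
    obtain ⟨w⟩ := hM.nonempty
    refine ⟨w, ?_⟩
    -- Witnesses: a `parent` head for fetching and shifting, a `colour` head for the three removals,
    -- a `palette` head for the greedy rounds.
    by_cases h1 : (t < (ℓ + 4) * N ∧ t % (ℓ + 4) = 0) ∨ t = (ℓ + 4) * N + 0 ∨
        t = (ℓ + 4) * N + 2 ∨ t = (ℓ + 4) * N + 4
    · refine ⟨.parent ⟨0, hΔ⟩ ⟨0, by omega⟩, ?_⟩
      simp only [rule, Rule.hotBody, Rule.select, Schema.holds_and, Schema.holds_or,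
        Schema.holds_var, hr, e0, hs0, hs2, hs4]
      rcases h1 with h1 | h1
      · rw [if_pos h1]; simp
      · have hnr : ¬ t < (ℓ + 4) * N := by omega
        simp only [hnr, false_and, if_false]
        rw [if_pos h1]
        split_ifs with hc
        · exact absurd ((hr w).1 hc.1) hnr
        · simp
    · by_cases h2 : (ℓ + 4) * N ≤ t ∧ t < (ℓ + 4) * N + 6
      · refine ⟨.colour ⟨0, hΔ⟩ ⟨0, by omega⟩, ?_⟩
        simp only [rule, Rule.hotBody, Rule.select, Schema.holds_and,
          Schema.holds_var, hr, hs1, hs3, hs5, not_lt.2 h2.1, false_and, if_false]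
        split_ifs <;> simp
        omega
      · refine ⟨.palette 0, ?_⟩
        simp only [rule, Rule.hotBody, Rule.select, Schema.holds_var, hg, hs6]
        rw [if_neg (by omega), if_pos (by omega)]
        simp [md_leastFreeS hΔ]

theorem commRounds_eq (hM : M.IsGraphModel Δ) (hN : 1 ≤ N) (hΔ : 1 ≤ Δ) :
    (typedProgram ℓ Δ N).toProgram.commRounds M =
      ((commTimes ℓ Δ N).map ⟨Nat.succ, Nat.succ_injective⟩ : Finset ℕ) := by
  rw [TypedProgram.commRounds_toProgram]
  ext r
  simp only [Set.mem_ofPred_eq, Finset.coe_map, Set.mem_image, Finset.mem_coe]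
  refine exists_congr fun t => ?_
  rw [← exists_md_pos_iff hM hN hΔ]
  exact ⟨fun ⟨h1, h2⟩ => ⟨h2, h1.symm⟩, fun ⟨h1, h2⟩ => ⟨h2.symm, h1⟩⟩

theorem encard_commRounds (hM : M.IsGraphModel Δ) (hN : 1 ≤ N) (hΔ : 1 ≤ Δ) :
    ((typedProgram ℓ Δ N).toProgram.commRounds M).encard = (N + 6 + (3 ^ Δ - Δ - 1) : ℕ) := by
  rw [commRounds_eq hM hN hΔ, Set.encard_coe_eq_coe_finsetCard, Finset.card_map,
    card_commTimes hΔ]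

/-! ### Output -/

theorem acceptsIn_iff (hN : 1 ≤ N) (w : W) (t : ℕ) :
    (typedProgram ℓ Δ N).toProgram.AcceptsIn M w t ↔ t = (ℓ + 4) * N + (3 ^ Δ + 6) := by
  have key : ∀ s, (typedProgram ℓ Δ N).config M s w (.step ⟨3 ^ Δ + 6, by omega⟩) ↔
      s = (ℓ + 4) * N + (3 ^ Δ + 6) := fun s => cfg_step M hN s w _
  rw [TypedProgram.acceptsIn_toProgram]
  simp only [typedProgram, Finset.mem_singleton, exists_eq_left, forall_eq] at key ⊢
  simp only [key]
  exact ⟨fun h => h.1, fun h => ⟨h, fun s hs => by omega⟩⟩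

theorem commRounds_inter_Iic (hM : M.IsGraphModel Δ) (hN : 1 ≤ N) (hΔ : 1 ≤ Δ) {w : W} {t : ℕ}
    (ht : (typedProgram ℓ Δ N).toProgram.AcceptsIn M w t) :
    (typedProgram ℓ Δ N).toProgram.commRounds M ∩ Set.Iic t =
      (typedProgram ℓ Δ N).toProgram.commRounds M := by
  have hpow := succ_lt_three_pow hΔ
  rw [acceptsIn_iff hN] at ht
  rw [Set.inter_eq_left, commRounds_eq hM hN hΔ]
  intro r hr
  simp only [Finset.coe_map, Set.mem_image, Finset.mem_coe] at hr
  obtain ⟨s, hs, rfl⟩ := hr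
  rw [mem_commTimes] at hs
  simp only [Function.Embedding.coeFn_mk, Set.mem_Iic, Nat.succ_eq_add_one]
  -- The last communication round is the output round itself, so the bound is attained with
  -- equality.
  omega

theorem definesProperColoring (hN : 1 ≤ N) (hℓ : 1 ≤ ℓ) (hΔ : 1 ≤ Δ)
    (hw : reducedWidth^[N - 1] ℓ ≤ 3) :
    Program.DefinesProperColoring.{u} (typedProgram ℓ Δ N).toProgram (Δ + 1) := by
  intro W M hM
  obtain ⟨f, hprop, hf⟩ := greedy_end (N := N) hM hN hℓ hΔ hw
  have hmem : ∀ X, X ∈ (typedProgram ℓ Δ N).print ↔ ∃ a, X = .palette a := by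
    intro X
    simp only [typedProgram, Finset.mem_map, Finset.mem_univ, true_and]
    exact exists_congr fun a => eq_comm
  have hcard : (typedProgram ℓ Δ N).print.card = Δ + 1 := by simp [typedProgram]
  constructor
  · intro w
    obtain ⟨a, b, ha, hab⟩ := (typedProgram ℓ Δ N).printString_toProgram M
      (w := w) (t := (ℓ + 4) * N + (3 ^ Δ + 6)) (X := .palette (f w)) ((hmem _).2 ⟨_, rfl⟩) (by
        intro Y hY
        obtain ⟨a, rfl⟩ := (hmem Y).1 hY
        refine (hf w a).trans ?_
        simp [eq_comm])
    exact ⟨_, a, b, hcard ▸ ha, (acceptsIn_iff hN w _).2 rfl, hab⟩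
  · rintro v w hR t t' s s' ⟨ht, hs⟩ ⟨ht', hs'⟩ rfl
    rw [acceptsIn_iff hN] at ht ht'
    subst ht ht'
    have := (typedProgram ℓ Δ N).config_iff_of_printString_eq M (hs.trans hs'.symm)
      ((hmem (.palette (f v))).2 ⟨_, rfl⟩)
    have h1 := (hf v (f v)).2 rfl
    exact hprop v w hR ((hf w (f v)).1 (this.1 h1)).symm

/-! ### Running time and asymptotics. -/

theorem time_le {Δ n : ℕ} (hΔ : 1 ≤ Δ) (hn : 1 ≤ n) :
    (bitLog n + 4) * (logStar n + 6) + (3 ^ Δ + 6) ≤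
      100 * (bitLog n * bitLog (bitLog n) * logStar n + Δ * 3 ^ Δ) := by
  have h3 : 3 ≤ 3 ^ Δ := Nat.le_self_pow (by omega) 3
  have hΔ3 : 3 ^ Δ ≤ Δ * 3 ^ Δ := Nat.le_mul_of_pos_left _ hΔ
  rcases Nat.lt_or_ge n 2 with h | h
  -- At n = 1 the iterated logarithm vanishes, so the Δ · 3^Δ term must absorb the whole running
  -- time.
  · have hn1 : n = 1 := by omega
    subst hn1
    have h1 : bitLog 1 = 1 := by simp [bitLog]
    have h2 : logStar 1 ≤ 1 := h1 ▸ logStar_le_bitLog 1 le_rfl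
    rw [h1]
    have h4 : bitLog 1 = 1 := h1
    rw [h4]
    omega
  · have h1 := one_le_logStar n h
    have h2 : 1 ≤ bitLog n := Nat.succ_pos _
    have h4 : 1 ≤ bitLog (bitLog n) := Nat.succ_pos _
    have h5 : (bitLog n + 4) * (logStar n + 6) ≤ (5 * bitLog n) * (7 * logStar n) :=
      Nat.mul_le_mul (by omega) (by omega)
    have h6 : bitLog n * logStar n ≤ bitLog n * bitLog (bitLog n) * logStar n :=
      Nat.mul_le_mul_right _ (Nat.le_mul_of_pos_right _ h4)
    have h7 : (5 * bitLog n) * (7 * logStar n) = 35 * (bitLog n * logStar n) := by ring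
    omega

theorem bitLog_isBigO_log : (fun n : ℕ => (bitLog n : ℝ)) =O[atTop] fun n : ℕ => Real.log n := by
  refine IsBigO.of_bound (2 / Real.log 2) ?_
  filter_upwards [eventually_ge_atTop 2] with n hn
  have hlog2 : 0 < Real.log 2 := Real.log_pos (by norm_num)
  have h1 : (Nat.log 2 n : ℝ) * Real.log 2 ≤ Real.log n := by
    rw [← Real.log_pow]
    refine Real.log_le_log (by positivity) ?_
    exact_mod_cast Nat.pow_log_le_self 2 (by omega)
  have h2 : Real.log 2 ≤ Real.log n := Real.log_le_log (by norm_num) (by exact_mod_cast hn)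
  rw [Real.norm_of_nonneg (by positivity), Real.norm_of_nonneg (by linarith), div_mul_eq_mul_div,
    le_div_iff₀ hlog2, bitLog]
  push_cast
  linarith

end Colouring
end MPMSC

theorem mainTheorem7 :
    ∃ P : (Δ n : ℕ) → Program (bitLog n) Δ,
      (∀ Δ n, 1 ≤ Δ → 1 ≤ n → Program.DefinesProperColoring.{u} (P Δ n) (Δ + 1)) ∧
      (∃ C : ℕ, ∀ Δ n, 1 ≤ Δ → 1 ≤ n →
        (P Δ n).heads ≤ C * (Δ * bitLog n + 3 ^ Δ) ∧
        (P Δ n).size ≤ C * (Δ ^ 2 * bitLog n + 3 ^ Δ)) ∧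
      (∃ C : ℕ, ∀ Δ n, 1 ≤ Δ → 1 ≤ n →
        ∀ (W : Type u) (M : KripkeModel (bitLog n) W), M.IsGraphModel Δ →
          ∀ w, ∃ t, (P Δ n).AcceptsIn M w t ∧
            t ≤ C * (bitLog n * bitLog (bitLog n) * logStar n + Δ * 3 ^ Δ)) ∧
      (∀ Δ n, 1 ≤ Δ → 1 ≤ n →
        ∀ (W : Type u) (M : KripkeModel (bitLog n) W), M.IsGraphModel Δ →
          ((P Δ n).commRounds M).encard = (logStar n + (3 ^ Δ - Δ) + 11 : ℕ) ∧
          ∀ w t, (P Δ n).AcceptsIn M w t →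
            ((P Δ n).commRounds M ∩ Set.Iic t).encard = (logStar n + (3 ^ Δ - Δ) + 11 : ℕ)) ∧
      (∀ Δ, 1 ≤ Δ →
        (fun n : ℕ => ((P Δ n).size : ℝ)) =O[atTop] fun n : ℕ => Real.log n) := by
  have hℓ : ∀ n, 1 ≤ bitLog n := fun n => Nat.succ_pos _
  have hN : ∀ n, 1 ≤ logStar n + 6 := fun n => by omega
  have hsize : ∀ Δ n, 1 ≤ Δ → 1 ≤ n →
      (Colouring.typedProgram (bitLog n) Δ (logStar n + 6)).toProgram.size ≤
        100000 * (Δ ^ 2 * bitLog n + 3 ^ Δ) := fun Δ n hΔ hn =>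
    Colouring.size_le (hℓ n) hΔ (by have := logStar_le_bitLog n hn; omega)
  -- Phases before the last number log* n + 5, where log* n + 2 are enough; the surplus makes the
  -- number of communication rounds, N + 6 + (3^Δ − Δ − 1) for N phases, equal to the stated one.
  refine ⟨fun Δ n => (Colouring.typedProgram (bitLog n) Δ (logStar n + 6)).toProgram,
    fun Δ n hΔ hn => ?_, ⟨100000, fun Δ n hΔ hn => ⟨?_, hsize Δ n hΔ hn⟩⟩,
    ⟨100, fun Δ n hΔ hn W M hM w => ?_⟩, fun Δ n hΔ hn W M hM => ?_, fun Δ hΔ => ?_⟩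
  · exact Colouring.definesProperColoring (hN n) (hℓ n) hΔ
      (iterate_reducedWidth_bitLog_le_three n _ hn (by omega))
  · refine (Colouring.heads_le (hℓ n) hΔ (by have := logStar_le_bitLog n hn; omega)).trans ?_
    exact Nat.mul_le_mul_right _ (by norm_num)
  · exact ⟨_, (Colouring.acceptsIn_iff (hN n) w _).2 rfl, Colouring.time_le hΔ hn⟩
  · have hpow := succ_lt_three_pow hΔ
    have hcount : logStar n + 6 + 6 + (3 ^ Δ - Δ - 1) = logStar n + (3 ^ Δ - Δ) + 11 := by omega
    have henc := Colouring.encard_commRounds hM (hN n) hΔ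
    rw [hcount] at henc
    refine ⟨henc, fun w t ht => ?_⟩
    rw [Colouring.commRounds_inter_Iic hM (hN n) hΔ ht]
    exact henc
  · refine IsBigO.trans (g := fun n : ℕ => (bitLog n : ℝ)) ?_ Colouring.bitLog_isBigO_log
    refine IsBigO.of_bound (100000 * (Δ ^ 2 + 3 ^ Δ)) ?_
    filter_upwards [eventually_ge_atTop 1] with n hn
    have h1 := hsize Δ n hΔ hn
    have h2 : 3 ^ Δ ≤ 3 ^ Δ * bitLog n := Nat.le_mul_of_pos_right _ (hℓ n)
    have h3 : (Colouring.typedProgram (bitLog n) Δ (logStar n + 6)).toProgram.size ≤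
        100000 * (Δ ^ 2 + 3 ^ Δ) * bitLog n := by nlinarith
    rw [Real.norm_of_nonneg (by positivity), Real.norm_of_nonneg (by positivity)]
    exact_mod_cast h3
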